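/- Let $H_n$ be the Hermite polynomials orthogonal for the weight $e^{-x^2}$ ($H_0=1$, $H_{n+1}=2xH_n-H_n'$). For $N\ge 1$ let the nodes $x_n$ be the real zeros of $H_N$, and let $$w_n=\frac{2^{N-1}N!\sqrt\pi}{N^2[H_{N-1}(x_n)]^2}.$$ For real $\alpha,b$ (with $\sqrt\alpha$ the principal complex square root, which is imaginary if $\alpha<0$) put $$R_N(\alpha,b)=\int_{-\infty}^{\infty}e^{-x^2-2x\sqrt\alpha\,b}\,dx-\sum_{n}w_n e^{-2x_n\sqrt\alpha\,b}.$$ Let $B$ be a bounded operator on a complex Banach space (for example, one that has an eigenbasis) and put $$\mathcal R_N(\alpha)=e^{\alpha B^2}-\frac1{\sqrt\pi}\sum_{n}w_n e^{-2x_n\sqrt\alpha B}.$$ Then: 1. For every $N\ge1$ there are exactly $N$ nodes, all weights are positive, and $\int_{-\infty}^\infty e^{-x^2}p(x)\,dx=\sum_n w_n p(x_n)$ for every real polynomial $p$ of degree at most $2N-1$. 2. $e^{\alpha b^2}=\pi^{-1/2}\int_{-\infty}^\infty e^{-x^2-2x\sqrt\alpha\,b}\,dx$ for all real $\alpha,b$.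 3. If $|\alpha b^2|<2$, then for every $N\ge2$ $$|R_N(\alpha,b)|\le 0.816\,\sqrt{2\pi}\,\pi^{1/4}\,e^{\alpha b^2}\sqrt{\frac{2}{2-|\alpha b^2|}}\left(\frac{|\alpha b^2|}{2}\right)^{N}\sqrt{\cosh 1},$$ and for $N=1$ the same bound holds with $0.816$ replaced by $1.1$. In particular the convergence in the number of nodes is geometric: for fixed $\alpha,b$ with $|\alpha b^2|<2$, $R_N(\alpha,b)=\mathcal O\big((|\alpha b^2|/2)^N\big)$ as $N\to\infty$. 4. For $N\ge1$, $\alpha,b\in\mathbb R$ and any vector $v$ with $Bv=bv$ we have $e^{\alpha B^2}v=e^{\alpha b^2}v$ and $\mathcal R_N(\alpha)v=\pi^{-1/2}R_N(\alpha,b)\,v$. For every fixed $N\ge1$, $$e^{\alpha B^2}=\frac1{\sqrt\pi}\sum_{n=1}^N w_n e^{-2x_n\sqrt\alpha B}+\mathcal O\big((\alpha B^2)^N\big)\qquad(\alpha\to0)$$ in operator norm, and if $|\alpha|\,\|B\|^2<2$ then $\|\mathcal R_N(\alpha)\|=\mathcal O\big((|\alpha|\|B\|^2/2)^N\big)$ as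 $N\to\infty$. -/

import Mathlib

open Polynomial

/-- The (physicists') Hermite polynomials `H_n`, orthogonal for the weight `exp (-x ^ 2)`:
`H_0 = 1` and `H_{n+1} = 2 x H_n - H_n'`. -/
noncomputable def physHermite : ℕ → ℝ[X]
  | 0 => 1
  | n + 1 => 2 * X * physHermite n - derivative (physHermite n)

/-- The Gauss-Hermite nodes: the real zeros of `H_N`. -/
noncomputable def ghNodes (N : ℕ) : Finset ℝ := (physHermite N).roots.toFinset

/-- The Gauss-Hermite weight of the node `x`:
`2 ^ (N - 1) N! √π / (N ^ 2 H_{N-1}(x) ^ 2)`, for `N ≥ 1`. -/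
noncomputable def ghWeight (N : ℕ) (x : ℝ) : ℝ :=
  (2 : ℝ) ^ (N - 1) * (N.factorial : ℝ) * Real.sqrt Real.pi /
    ((N : ℝ) ^ 2 * ((physHermite (N - 1)).eval x) ^ 2)

/-- The square root of a real number as a complex number (imaginary if `α < 0`). -/
noncomputable def csqrt (α : ℝ) : ℂ := (α : ℂ) ^ (1 / 2 : ℂ)

/-- The Gaussian integral `∫ exp (-x ^ 2) exp (-2 x √α b) dx`. -/
noncomputable def hsIntegral (α b : ℝ) : ℂ :=
  ∫ x : ℝ, Complex.exp (-(x : ℂ) ^ 2 - 2 * (x : ℂ) * csqrt α * (b : ℂ))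

/-- The quadrature sum `∑ w_n exp (-2 x_n √α b)`. -/
noncomputable def hsQuadrature (N : ℕ) (α b : ℝ) : ℂ :=
  ∑ x ∈ ghNodes N, (ghWeight N x : ℂ) * Complex.exp (-2 * (x : ℂ) * csqrt α * (b : ℂ))

/-- The remainder `R_N` of the quadrature (its modulus is the quadrature error). -/
noncomputable def hsRemainder (N : ℕ) (α b : ℝ) : ℂ := hsIntegral α b - hsQuadrature N α b

/-- The error bound
`C √(2π) π^{1/4} exp (α b²) √(2 / (2 - |α b²|)) (|α b²| / 2) ^ N √(cosh 1)`. -/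
noncomputable def hsBound (C : ℝ) (N : ℕ) (α b : ℝ) : ℝ :=
  C * Real.sqrt (2 * Real.pi) * Real.pi ^ (1 / 4 : ℝ) * Real.exp (α * b ^ 2) *
    Real.sqrt (2 / (2 - |α * b ^ 2|)) * (|α * b ^ 2| / 2) ^ N * Real.sqrt (Real.cosh 1)

section Operator

variable {E : Type*} [NormedAddCommGroup E] [NormedSpace ℂ E]

/-- The discrete Hubbard-Stratonovich sum `π^{-1/2} ∑ w_n exp (-2 x_n √α B)`. -/
noncomputable def hsOperatorSum (N : ℕ) (α : ℝ) (B : E →L[ℂ] E) : E →L[ℂ] E :=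
  (1 / (Real.sqrt Real.pi : ℂ)) •
    ∑ x ∈ ghNodes N, (ghWeight N x : ℂ) • NormedSpace.exp ((-2 * (x : ℂ) * csqrt α) • B)

/-- The operator remainder `exp (α B²) - π^{-1/2} ∑ w_n exp (-2 x_n √α B)`. -/
noncomputable def hsOperatorRemainder (N : ℕ) (α : ℝ) (B : E →L[ℂ] E) : E →L[ℂ] E :=
  NormedSpace.exp ((α : ℂ) • B ^ 2) - hsOperatorSum N α B

end Operator

/-! ### Algebra of the Hermite polynomials -/

/-! Expand every exponential. Up to the factor `√π`, the scalar remainder is a power series `F(s) =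
∑ c_k s ^ k` in `s = α b²`; the operator remainder is the same series in `α B²`, without that
factor. Only integral powers of `α` survive because the odd moments of the rule vanish. Everything
rests on two properties of the coefficients `c_k` (`ghRemainderCoeff`): `c_k = 0` for `k < N`, and
`0 ≤ c_k ≤ 1 / k!` for all `k`.

Both come from `x H_j = H_{j+1} / 2 + j H_{j-1}`. The Christoffel-Darboux identity at the nodes says
that two square matrices are inverse to each other, so the rule and the Gaussian integral agree on
`H_0, ..., H_{N-1}`. On `x ^ m H_j` they obey the same recursion in `m`, with nonnegative
coefficients, except that the rule annihilates `x ^ m H_N`. This gives equality for `j ≤ N`, `m + j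
< 2 N` (exactness), and for `j < N` and every `m` the comparison `0 ≤ rule ≤ integral`
(`ghFunctional_X_pow_mul_physHermite_mem`). No derivative form of the quadrature error is needed.

The operator estimates follow by dominating the series by `T ^ N exp ‖T‖ / N!`. The scalar bound for
`s ≥ 0` is the same domination with explicit constants. For `s = -y < 0` the claimed bound contains
`exp (-y) √(2 / (2 - y))`, whose minimum on `[0, 2)` is `2 exp (-3/2)`, about 0.446. A tail estimate
of the series beats this for `N ≥ 5`; for `N ≤ 4` the first terms are treated separately, with exact
coefficients when `N ≤ 3`. -/

lemma derivative_physHermite_succ (n : ℕ) :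
    derivative (physHermite (n + 1)) = C (2 * (n + 1 : ℝ)) * physHermite n := by
  induction n with
  | zero => simp [physHermite, show (2 : ℝ[X]) = C 2 from rfl]
  | succ n ih =>
    have h : physHermite (n + 2) = 2 * X * physHermite (n + 1) -
        C (2 * (n + 1 : ℝ)) * physHermite n := by
      rw [← ih]; rfl
    have h1 : physHermite (n + 1) = 2 * X * physHermite n - derivative (physHermite n) := rfl
    have h2 : derivative (2 * X * physHermite (n + 1)) =
        2 * physHermite (n + 1) + 2 * X * derivative (physHermite (n + 1)) := by
      simp [derivative_mul]
    rw [h, derivative_sub, h2, derivative_C_mul, ih]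
    have h3 : (C (2 * (((n + 1 : ℕ) : ℝ) + 1)) : ℝ[X]) = C (2 * (n + 1 : ℝ)) + 2 := by
      rw [show (2 : ℝ[X]) = C 2 from rfl, ← C_add]
      congr 1; push_cast; ring
    rw [h3]
    linear_combination (-C (2 * (n + 1 : ℝ))) * h1

lemma physHermite_add_two (n : ℕ) :
    physHermite (n + 2) = 2 * X * physHermite (n + 1) -
      C (2 * (n + 1 : ℝ)) * physHermite n := by
  rw [← derivative_physHermite_succ]; rfl

lemma natDegree_physHermite_le (n : ℕ) : (physHermite n).natDegree ≤ n := by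
  induction n with
  | zero => simp [physHermite]
  | succ n ih =>
    rw [physHermite]
    refine (natDegree_sub_le _ _).trans (max_le ?_ ?_)
    · refine natDegree_mul_le.trans ?_
      have : (2 * X : ℝ[X]).natDegree ≤ 1 := by
        rw [show (2 : ℝ[X]) = C 2 from rfl]; exact (natDegree_C_mul_le 2 X).trans natDegree_X_le
      omega
    · exact (natDegree_derivative_le _).trans (by omega)

lemma coeff_physHermite_self (n : ℕ) : (physHermite n).coeff n = 2 ^ n := by
  induction n with
  | zero => simp [physHermite]
  | succ n ih =>
    rw [physHermite, coeff_sub, show (2 : ℝ[X]) = C 2 from rfl, mul_assoc, coeff_C_mul,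
      coeff_X_mul, ih, coeff_derivative, coeff_eq_zero_of_natDegree_lt]
    · ring
    · exact lt_of_le_of_lt (natDegree_physHermite_le n) (by omega)

lemma physHermite_ne_zero (n : ℕ) : physHermite n ≠ 0 := by
  intro h
  have := coeff_physHermite_self n
  rw [h, coeff_zero] at this
  exact pow_ne_zero n two_ne_zero this.symm

lemma natDegree_physHermite (n : ℕ) : (physHermite n).natDegree = n :=
  le_antisymm (natDegree_physHermite_le n) <|
    le_natDegree_of_ne_zero <| by rw [coeff_physHermite_self]; positivity

lemma mem_ghNodes {N : ℕ} {x : ℝ} : x ∈ ghNodes N ↔ (physHermite N).eval x = 0 := by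
  rw [ghNodes, Multiset.mem_toFinset, mem_roots (physHermite_ne_zero N), IsRoot.def]

/-- General scalars are needed because the zeros are first located in `ℂ`. -/
lemma aeval_physHermite_add_two {K : Type*} [CommRing K] [Algebra ℝ K] (x : K) (n : ℕ) :
    aeval x (physHermite (n + 2)) = 2 * x * aeval x (physHermite (n + 1)) -
      2 * (n + 1 : K) * aeval x (physHermite n) := by
  rw [physHermite_add_two]
  simp [map_ofNat]

lemma eval_physHermite_add_two (x : ℝ) (n : ℕ) :
    (physHermite (n + 2)).eval x = 2 * x * (physHermite (n + 1)).eval x -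
      2 * (n + 1 : ℝ) * (physHermite n).eval x := by
  simpa [aeval_def] using aeval_physHermite_add_two x n

/-- The Christoffel-Darboux identity for the Hermite polynomials. -/
lemma christoffelDarboux_physHermite {K : Type*} [Field K] [CharZero K] [Algebra ℝ K]
    (x y : K) (n : ℕ) :
    (x - y) * ∑ j ∈ Finset.range (n + 1), aeval x (physHermite j) * aeval y (physHermite j) /
        (2 ^ j * (j.factorial : K)) =
      (aeval x (physHermite (n + 1)) * aeval y (physHermite n) -
        aeval x (physHermite n) * aeval y (physHermite (n + 1))) /
          (2 ^ (n + 1) * (n.factorial : K)) := by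
  induction n with
  | zero =>
    simp [physHermite, map_ofNat]; ring
  | succ n ih =>
    rw [Finset.sum_range_succ, mul_add, ih, aeval_physHermite_add_two, aeval_physHermite_add_two]
    have h1 : (n.factorial : K) ≠ 0 := Nat.cast_ne_zero.2 n.factorial_ne_zero
    have h2 : ((n : K) + 1) ≠ 0 := Nat.cast_add_one_ne_zero n
    rw [Nat.factorial_succ]
    push_cast
    field_simp
    ring

/-- The confluent Christoffel-Darboux identity for the Hermite polynomials. -/
lemma christoffelDarboux_physHermite_self (x : ℝ) (n : ℕ) :
    ∑ j ∈ Finset.range (n + 1), (physHermite j).eval x ^ 2 / (2 ^ j * (j.factorial : ℝ)) =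
      ((2 * (n + 1 : ℝ)) * (physHermite n).eval x ^ 2 -
        (derivative (physHermite n)).eval x * (physHermite (n + 1)).eval x) /
          (2 ^ (n + 1) * (n.factorial : ℝ)) := by
  induction n with
  | zero => simp [physHermite]
  | succ n ih =>
    rw [Finset.sum_range_succ, ih, eval_physHermite_add_two, derivative_physHermite_succ]
    have h0 : (derivative (physHermite n)).eval x =
        2 * x * (physHermite n).eval x - (physHermite (n + 1)).eval x := by
      simp [physHermite]
    have h1 : (n.factorial : ℝ) ≠ 0 := Nat.cast_ne_zero.2 n.factorial_ne_zero
    have h2 : ((n : ℝ) + 1) ≠ 0 := Nat.cast_add_one_ne_zero n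
    rw [h0, Nat.factorial_succ, eval_mul, eval_C]
    push_cast
    field_simp
    ring

/-- A common zero of two consecutive polynomials would descend through the recurrence to `H_0 = 1`.
Since `H_{n+1}'` is a multiple of `H_n`, this also makes the zeros simple. -/
lemma aeval_physHermite_ne_zero_of_succ {K : Type*} [Field K] [CharZero K] [Algebra ℝ K]
    (x : K) (n : ℕ) (h : aeval x (physHermite (n + 1)) = 0) : aeval x (physHermite n) ≠ 0 := by
  induction n with
  | zero => simp [physHermite]
  | succ n ih =>
    intro h0
    rw [aeval_physHermite_add_two, h0] at h
    have h2 : ((n : K) + 1) ≠ 0 := Nat.cast_add_one_ne_zero n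
    have h3 : aeval x (physHermite n) = 0 := by
      have : 2 * ((n : K) + 1) * aeval x (physHermite n) = 0 := by linear_combination -h
      simpa [h2] using this
    exact ih h0 h3

/-- The complex zeros of a Hermite polynomial are real. -/
lemma im_eq_zero_of_aeval_physHermite_eq_zero (n : ℕ) (z : ℂ)
    (hz : aeval z (physHermite n) = 0) : z.im = 0 := by
  cases n with
  | zero => simp [physHermite] at hz
  | succ n =>
    have hconj : ∀ j, aeval ((starRingEnd ℂ) z) (physHermite j) =
        (starRingEnd ℂ) (aeval z (physHermite j)) := fun j => by
      simpa using aeval_algHom_apply (Complex.conjAe : ℂ →ₐ[ℝ] ℂ) z (physHermite j)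
    -- At `z` and its conjugate the right side vanishes, while the sum is `∑ |H_j(z)|² / (2 ^ j
    -- j!)`, positive because of its term `j = 0`.
    have h := christoffelDarboux_physHermite z ((starRingEnd ℂ) z) n
    rw [hconj (n + 1), hz, map_zero, zero_mul, mul_zero, sub_zero, zero_div] at h
    rcases mul_eq_zero.1 h with h | h
    · have := congrArg Complex.im h
      simp at this
      linarith
    · exfalso
      have h2 : ∑ j ∈ Finset.range (n + 1), ‖aeval z (physHermite j)‖ ^ 2 /
          (2 ^ j * (j.factorial : ℝ)) = 0 := by
        have : ((∑ j ∈ Finset.range (n + 1), ‖aeval z (physHermite j)‖ ^ 2 /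
          (2 ^ j * (j.factorial : ℝ)) : ℝ) : ℂ) = 0 := by
          rw [← h]
          push_cast
          refine Finset.sum_congr rfl fun j _ => ?_
          rw [hconj, Complex.mul_conj, Complex.normSq_eq_norm_sq]
          push_cast; rfl
        exact_mod_cast this
      have h3 := (Finset.sum_eq_zero_iff_of_nonneg (fun j _ => by positivity)).1 h2 0 (by simp)
      simp [physHermite] at h3

/-- `H_N` has exactly `N` real zeros. -/
lemma card_ghNodes (N : ℕ) : (ghNodes N).card = N := by
  refine le_antisymm ?_ ?_
  · calc (ghNodes N).card ≤ Multiset.card (physHermite N).roots := Multiset.toFinset_card_le _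
      _ ≤ (physHermite N).natDegree := card_roots' _
      _ = N := natDegree_physHermite N
  · cases N with
    | zero => simp
    | succ n =>
      -- Count over `ℂ`, where the polynomial splits: the roots are simple and real.
      set p := (physHermite (n + 1)).map (algebraMap ℝ ℂ) with hp
      have hp0 : p ≠ 0 := (Polynomial.map_ne_zero_iff (algebraMap ℝ ℂ).injective).2
        (physHermite_ne_zero _)
      have hroot : ∀ z, z ∈ p.roots → aeval z (physHermite (n + 1)) = 0 := fun z hz => by
        rw [mem_roots hp0, IsRoot.def, hp, eval_map_algebraMap] at hz
        exact hz
      have hnodup : p.roots.Nodup := by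
        rw [Multiset.nodup_iff_count_le_one]
        intro z
        by_cases hz : z ∈ p.roots
        · rw [count_roots]
          by_contra! hlt
          have := (one_lt_rootMultiplicity_iff_isRoot hp0).1 hlt
          have h2 := this.2
          rw [hp, derivative_map, IsRoot.def, eval_map_algebraMap, derivative_physHermite_succ,
            map_mul, aeval_C] at h2
          refine aeval_physHermite_ne_zero_of_succ z n (hroot z hz) ?_
          rcases mul_eq_zero.1 h2 with h3 | h3
          · exfalso
            rw [map_eq_zero] at h3
            have : (0 : ℝ) < n + 1 := by positivity
            linarith
          · exact h3
        · rw [Multiset.count_eq_zero_of_notMem hz]; exact Nat.zero_le _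
      have hcard : p.roots.toFinset.card = n + 1 := by
        rw [Multiset.toFinset_card_of_nodup hnodup,
          splits_iff_card_roots.1 (IsAlgClosed.splits p), hp, natDegree_map, natDegree_physHermite]
      have hsub : p.roots.toFinset ⊆ (ghNodes (n + 1)).image (fun x : ℝ => (x : ℂ)) := by
        intro z hz
        rw [Multiset.mem_toFinset] at hz
        have h0 := hroot z hz
        have him := im_eq_zero_of_aeval_physHermite_eq_zero _ z h0
        have hzr : ((z.re : ℝ) : ℂ) = z := Complex.ext (by simp) (by simp [him])
        refine Finset.mem_image.2 ⟨z.re, ?_, hzr⟩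
        rw [mem_ghNodes]
        rw [← hzr] at h0
        have := aeval_algebraMap_apply ℂ z.re (physHermite (n + 1))
        rw [Complex.coe_algebraMap] at this
        rw [this] at h0
        rw [← coe_aeval_eq_eval]
        exact_mod_cast h0
      calc n + 1 = p.roots.toFinset.card := hcard.symm
        _ ≤ _ := Finset.card_le_card hsub
        _ ≤ _ := Finset.card_image_le

lemma eval_physHermite_pred_ne_zero {N : ℕ} (hN : 1 ≤ N) {x : ℝ} (hx : x ∈ ghNodes N) :
    (physHermite (N - 1)).eval x ≠ 0 := by
  obtain ⟨n, rfl⟩ : ∃ n, N = n + 1 := ⟨N - 1, by omega⟩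
  rw [mem_ghNodes] at hx
  simpa [aeval_def] using aeval_physHermite_ne_zero_of_succ x n (by simpa [aeval_def] using hx)

lemma ghWeight_pos {N : ℕ} (hN : 1 ≤ N) {x : ℝ} (hx : x ∈ ghNodes N) : 0 < ghWeight N x := by
  have h := eval_physHermite_pred_ne_zero hN hx
  have hN' : (0 : ℝ) < N := by exact_mod_cast hN
  have : 0 < (physHermite (N - 1)).eval x ^ 2 := by positivity
  unfold ghWeight
  have := Real.pi_pos
  positivity

/-! ### Discrete orthogonality at the nodes -/

/-- The kernel of the Hermite polynomials of degree less than `N` is diagonal on the nodes. -/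
lemma sum_physHermite_mul_node {N : ℕ} (hN : 1 ≤ N) {x y : ℝ} (hx : x ∈ ghNodes N)
    (hy : y ∈ ghNodes N) :
    ∑ j ∈ Finset.range N, (physHermite j).eval x * (physHermite j).eval y /
      (2 ^ j * (j.factorial : ℝ)) = if x = y then Real.sqrt Real.pi / ghWeight N x else 0 := by
  have hx0 := eval_physHermite_pred_ne_zero hN hx
  obtain ⟨n, rfl⟩ : ∃ n, N = n + 1 := ⟨N - 1, by omega⟩
  have hx' := mem_ghNodes.1 hx
  have hy' := mem_ghNodes.1 hy
  split_ifs with h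
  · subst h
    have := christoffelDarboux_physHermite_self x n
    rw [hx', mul_zero, sub_zero] at this
    simp only [← sq]
    rw [this, ghWeight]
    have h1 : (n.factorial : ℝ) ≠ 0 := Nat.cast_ne_zero.2 n.factorial_ne_zero
    have h2 : ((n : ℝ) + 1) ≠ 0 := Nat.cast_add_one_ne_zero n
    have h3 : Real.sqrt Real.pi ≠ 0 := (Real.sqrt_pos.2 Real.pi_pos).ne'
    simp only [Nat.add_sub_cancel] at hx0 ⊢
    rw [Nat.factorial_succ]
    push_cast
    field_simp
    ring
  · have := christoffelDarboux_physHermite x y n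
    simp only [coe_aeval_eq_eval] at this
    rw [hx', hy', mul_zero, zero_mul, sub_zero, zero_div] at this
    exact (mul_eq_zero.1 this).resolve_left (sub_ne_zero.2 h)

/-- The quadrature rule integrates `H_j`, `j < N`, exactly. -/
lemma sum_ghWeight_mul_physHermite {N j : ℕ} (hj : j < N) :
    ∑ x ∈ ghNodes N, ghWeight N x * (physHermite j).eval x =
      if j = 0 then Real.sqrt Real.pi else 0 := by
  have hN : 1 ≤ N := by omega
  let A : Matrix (ghNodes N) (Fin N) ℝ := fun x j => (physHermite j).eval x.1
  let D : Matrix (Fin N) (ghNodes N) ℝ := fun j x => (physHermite j).eval x.1 * ghWeight N x.1 /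
    (2 ^ (j : ℕ) * ((j : ℕ).factorial : ℝ) * Real.sqrt Real.pi)
  have hpi : Real.sqrt Real.pi ≠ 0 := (Real.sqrt_pos.2 Real.pi_pos).ne'
  have hAD : A * D = 1 := by
    ext x y
    rw [Matrix.mul_apply, Matrix.one_apply]
    have h := sum_physHermite_mul_node hN x.2 y.2
    rw [← Fin.sum_univ_eq_sum_range (fun j => (physHermite j).eval x.1 * (physHermite j).eval y.1 /
      (2 ^ j * (j.factorial : ℝ)))] at h
    have hw := (ghWeight_pos hN y.2).ne'
    have e : ∑ j, A x j * D j y = (ghWeight N y / Real.sqrt Real.pi) *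
        ∑ j : Fin N, (physHermite j).eval x.1 * (physHermite j).eval y.1 /
          (2 ^ (j : ℕ) * ((j : ℕ).factorial : ℝ)) := by
      rw [Finset.mul_sum]
      refine Finset.sum_congr rfl fun j _ => ?_
      simp only [A, D]
      field_simp
    rw [e, h]
    by_cases hxy : x = y
    · subst hxy
      simp only [if_true]
      field_simp
    · rw [if_neg hxy, if_neg (fun h => hxy (Subtype.ext h)), mul_zero]
  -- There are as many nodes as degrees, so the right inverse is a left inverse; row 0 of `D * A` is
  -- the claim.
  have hDA : D * A = 1 :=
    (Matrix.mul_eq_one_comm_of_card_eq _ _ _ (by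
      rw [Fintype.card_coe, card_ghNodes, Fintype.card_fin])).1 hAD
  have h := congrFun (congrFun hDA ⟨0, hN⟩) ⟨j, hj⟩
  rw [Matrix.mul_apply, Matrix.one_apply, Finset.sum_coe_sort (ghNodes N)
    (fun x => (physHermite 0).eval x * ghWeight N x /
    (2 ^ 0 * ((0 : ℕ).factorial : ℝ) * Real.sqrt Real.pi) * (physHermite j).eval x)] at h
  have e : ∑ x ∈ ghNodes N, ghWeight N x * (physHermite j).eval x = Real.sqrt Real.pi *
      ∑ x ∈ ghNodes N, (physHermite 0).eval x * ghWeight N x /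
      (2 ^ 0 * ((0 : ℕ).factorial : ℝ) * Real.sqrt Real.pi) * (physHermite j).eval x := by
    rw [Finset.mul_sum]
    refine Finset.sum_congr rfl fun x _ => ?_
    simp [physHermite]
    field_simp
  rw [e, h]
  by_cases h0 : j = 0
  · simp [h0]
  · simp [h0, Ne.symm h0]

/-! ### The Gaussian functional and the quadrature functional -/

lemma integrable_exp_neg_sq_mul_eval (p : ℝ[X]) :
    MeasureTheory.Integrable fun x : ℝ => Real.exp (-x ^ 2) * p.eval x := by
  induction p using Polynomial.induction_on' with
  | add p q hp hq =>
    exact (hp.add hq).congr (Filter.Eventually.of_forall fun x => by simp [mul_add])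
  | monomial n a =>
    have h := integrable_rpow_mul_exp_neg_mul_sq (b := 1) one_pos (s := n)
      (by have : (0 : ℝ) ≤ n := n.cast_nonneg
          linarith)
    refine (h.const_mul a).congr (Filter.Eventually.of_forall fun x => ?_)
    simp only [eval_monomial, Real.rpow_natCast, neg_mul, one_mul]
    ring

/-- The functional `p ↦ ∫ exp (-x ^ 2) p(x) dx`. -/
noncomputable def gaussianFunctional : ℝ[X] →ₗ[ℝ] ℝ where
  toFun p := ∫ x : ℝ, Real.exp (-x ^ 2) * p.eval x
  map_add' p q := by
    rw [← MeasureTheory.integral_add (integrable_exp_neg_sq_mul_eval p)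
      (integrable_exp_neg_sq_mul_eval q)]
    simp only [eval_add, mul_add]
  map_smul' c p := by
    rw [RingHom.id_apply, smul_eq_mul, ← MeasureTheory.integral_const_mul]
    refine MeasureTheory.integral_congr_ae (Filter.Eventually.of_forall fun x => ?_)
    simp only [eval_smul, smul_eq_mul]
    ring

/-- The Gauss-Hermite functional `p ↦ ∑ w_n p(x_n)`. -/
noncomputable def ghFunctional (N : ℕ) : ℝ[X] →ₗ[ℝ] ℝ where
  toFun p := ∑ x ∈ ghNodes N, ghWeight N x * p.eval x
  map_add' p q := by simp only [eval_add, mul_add, Finset.sum_add_distrib]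
  map_smul' c p := by
    simp only [eval_smul, smul_eq_mul, RingHom.id_apply, Finset.mul_sum]
    exact Finset.sum_congr rfl fun x _ => by ring

lemma gaussianFunctional_apply (p : ℝ[X]) :
    gaussianFunctional p = ∫ x : ℝ, Real.exp (-x ^ 2) * p.eval x := rfl

lemma ghFunctional_apply (N : ℕ) (p : ℝ[X]) :
    ghFunctional N p = ∑ x ∈ ghNodes N, ghWeight N x * p.eval x := rfl

lemma gaussianFunctional_one : gaussianFunctional 1 = Real.sqrt Real.pi := by
  rw [gaussianFunctional_apply]
  simpa using integral_gaussian 1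

/-- Integration by parts against the Gaussian weight. -/
lemma gaussianFunctional_sub_derivative (p : ℝ[X]) :
    gaussianFunctional (2 * X * p - derivative p) = 0 := by
  have hd : ∀ x : ℝ, HasDerivAt (fun x : ℝ => Real.exp (-x ^ 2) * p.eval x)
      (-(Real.exp (-x ^ 2) * (2 * X * p - derivative p).eval x)) x := fun x => by
    have h1 : HasDerivAt (fun x : ℝ => Real.exp (-x ^ 2)) (Real.exp (-x ^ 2) * -(2 * x)) x := by
      simpa using ((hasDerivAt_pow 2 x).neg).exp
    refine (h1.mul (p.hasDerivAt x)).congr_deriv ?_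
    simp only [eval_sub, eval_mul, eval_X, eval_ofNat]
    ring
  have h := MeasureTheory.integral_eq_zero_of_hasDerivAt_of_integrable hd
    (integrable_exp_neg_sq_mul_eval _).neg (integrable_exp_neg_sq_mul_eval p)
  rw [MeasureTheory.integral_neg, neg_eq_zero] at h
  exact h

lemma gaussianFunctional_physHermite (j : ℕ) :
    gaussianFunctional (physHermite j) = if j = 0 then Real.sqrt Real.pi else 0 := by
  cases j with
  | zero => simpa [physHermite] using gaussianFunctional_one
  | succ j => exact gaussianFunctional_sub_derivative (physHermite j)

/-- Both coefficients are nonnegative, which drives all the comparisons of moments below. -/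
lemma X_mul_physHermite_succ (j : ℕ) : X * physHermite (j + 1) =
    (1 / 2 : ℝ) • physHermite (j + 2) + (j + 1 : ℝ) • physHermite j := by
  rw [physHermite_add_two, smul_eq_C_mul, smul_eq_C_mul]
  have h1 : (C (1 / 2) * C (2 * (j + 1 : ℝ)) : ℝ[X]) = C (j + 1 : ℝ) := by
    rw [← C_mul]; congr 1; ring
  have h2 : (C (1 / 2) * 2 : ℝ[X]) = 1 := by
    rw [show (2 : ℝ[X]) = C 2 from rfl, ← C_mul]; norm_num
  linear_combination (-physHermite j) * h1 * (-1) - (X * physHermite (j + 1)) * h2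

lemma X_mul_physHermite_zero : X * physHermite 0 = (1 / 2 : ℝ) • physHermite 1 := by
  have h2 : (C (1 / 2) * 2 : ℝ[X]) = 1 := by
    rw [show (2 : ℝ[X]) = C 2 from rfl, ← C_mul]; norm_num
  rw [smul_eq_C_mul]
  simp only [physHermite, derivative_one]
  linear_combination (-X) * h2

/-- A linear functional on `x ^ (m + 1) H_j` is expressed by its values on `x ^ m H_i`. -/
lemma map_X_pow_succ_mul_physHermite_succ (L : ℝ[X] →ₗ[ℝ] ℝ) (m j : ℕ) :
    L (X ^ (m + 1) * physHermite (j + 1)) = 1 / 2 * L (X ^ m * physHermite (j + 2)) +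
      (j + 1 : ℝ) * L (X ^ m * physHermite j) := by
  rw [pow_succ, mul_assoc, X_mul_physHermite_succ, mul_add, map_add, mul_smul_comm, mul_smul_comm,
    map_smul, map_smul, smul_eq_mul, smul_eq_mul]

lemma map_X_pow_succ_mul_physHermite_zero (L : ℝ[X] →ₗ[ℝ] ℝ) (m : ℕ) :
    L (X ^ (m + 1) * physHermite 0) = 1 / 2 * L (X ^ m * physHermite 1) := by
  rw [pow_succ, mul_assoc, X_mul_physHermite_zero, mul_smul_comm, map_smul, smul_eq_mul]

lemma gaussianFunctional_X_pow_mul_physHermite_nonneg (m j : ℕ) :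
    0 ≤ gaussianFunctional (X ^ m * physHermite j) := by
  induction m generalizing j with
  | zero =>
    rw [pow_zero, one_mul, gaussianFunctional_physHermite]
    split_ifs <;> positivity
  | succ m ih =>
    cases j with
    | zero =>
      rw [map_X_pow_succ_mul_physHermite_zero]
      have := ih 1
      positivity
    | succ j =>
      rw [map_X_pow_succ_mul_physHermite_succ]
      have := ih (j + 2)
      have := ih j
      positivity

lemma gaussianFunctional_X_pow_mul_physHermite_eq_zero {m j : ℕ} (h : m < j) :
    gaussianFunctional (X ^ m * physHermite j) = 0 := by
  induction m generalizing j with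
  | zero => rw [pow_zero, one_mul, gaussianFunctional_physHermite, if_neg (by omega)]
  | succ m ih =>
    obtain ⟨j, rfl⟩ : ∃ i, j = i + 1 := ⟨j - 1, by omega⟩
    rw [map_X_pow_succ_mul_physHermite_succ, ih (by omega), ih (by omega)]
    simp

lemma ghFunctional_mul_physHermite (N : ℕ) (p : ℝ[X]) :
    ghFunctional N (p * physHermite N) = 0 := by
  rw [ghFunctional_apply]
  refine Finset.sum_eq_zero fun x hx => ?_
  rw [eval_mul, mem_ghNodes.1 hx, mul_zero, mul_zero]

lemma ghFunctional_physHermite {N j : ℕ} (h : j < N) : ghFunctional N (physHermite j) =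
    gaussianFunctional (physHermite j) := by
  rw [ghFunctional_apply, sum_ghWeight_mul_physHermite h, gaussianFunctional_physHermite]

/-- The recursion lowers `m` by one and moves `j` by one, so `m + j` never grows. When `j` reaches
`N`, the degree condition leaves `m < N`, and the Gaussian side vanishes by orthogonality just as
the rule does. -/
lemma ghFunctional_X_pow_mul_physHermite {N m j : ℕ} (hj : j ≤ N) (h : m + j < 2 * N) :
    ghFunctional N (X ^ m * physHermite j) = gaussianFunctional (X ^ m * physHermite j) := by
  induction m generalizing j with
  | zero =>
    rcases hj.lt_or_eq with hj | rfl
    · rw [pow_zero, one_mul, ghFunctional_physHermite hj]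
    · rw [ghFunctional_mul_physHermite,
        gaussianFunctional_X_pow_mul_physHermite_eq_zero (by omega)]
  | succ m ih =>
    rcases hj.lt_or_eq with hj | rfl
    · cases j with
      | zero =>
        rw [map_X_pow_succ_mul_physHermite_zero, map_X_pow_succ_mul_physHermite_zero,
          ih (by omega) (by omega)]
      | succ j =>
        rw [map_X_pow_succ_mul_physHermite_succ, map_X_pow_succ_mul_physHermite_succ,
          ih (by omega) (by omega), ih (by omega) (by omega)]
    · rw [ghFunctional_mul_physHermite,
        gaussianFunctional_X_pow_mul_physHermite_eq_zero (by omega)]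

/-- The `N`-point Gauss-Hermite rule is exact up to degree `2 N - 1`. -/
lemma ghFunctional_eq_gaussianFunctional {N : ℕ} (hN : 1 ≤ N) {p : ℝ[X]}
    (hp : p.natDegree ≤ 2 * N - 1) : ghFunctional N p = gaussianFunctional p := by
  rw [p.as_sum_range' (2 * N) (by omega), map_sum, map_sum]
  refine Finset.sum_congr rfl fun m hm => ?_
  rw [← smul_X_eq_monomial, map_smul, map_smul]
  have := ghFunctional_X_pow_mul_physHermite (m := m) (j := 0) (Nat.zero_le N)
    (by simpa using hm)
  rw [physHermite, mul_one] at this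
  rw [this]

/-- The two recursions differ only at `j = N`, where the rule gives zero and the integral a
nonnegative number; nonnegative coefficients propagate the inequality. -/
lemma ghFunctional_X_pow_mul_physHermite_mem {N m j : ℕ} (hj : j < N) :
    0 ≤ ghFunctional N (X ^ m * physHermite j) ∧
      ghFunctional N (X ^ m * physHermite j) ≤ gaussianFunctional (X ^ m * physHermite j) := by
  induction m generalizing j with
  | zero =>
    rw [ghFunctional_X_pow_mul_physHermite hj.le (by omega)]
    exact ⟨gaussianFunctional_X_pow_mul_physHermite_nonneg 0 j, le_rfl⟩
  | succ m ih =>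
    have ih' : ∀ {i}, i ≤ N → 0 ≤ ghFunctional N (X ^ m * physHermite i) ∧
      ghFunctional N (X ^ m * physHermite i) ≤ gaussianFunctional (X ^ m * physHermite i) := by
      intro i hi
      rcases hi.lt_or_eq with hi | rfl
      · exact ih hi
      · rw [ghFunctional_mul_physHermite]
        exact ⟨le_rfl, gaussianFunctional_X_pow_mul_physHermite_nonneg m i⟩
    cases j with
    | zero =>
      rw [map_X_pow_succ_mul_physHermite_zero, map_X_pow_succ_mul_physHermite_zero]
      obtain ⟨h1, h2⟩ := ih' (i := 1) (by omega)
      exact ⟨by positivity, by linarith⟩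
    | succ j =>
      rw [map_X_pow_succ_mul_physHermite_succ, map_X_pow_succ_mul_physHermite_succ]
      obtain ⟨h1, h2⟩ := ih' (i := j + 2) (by omega)
      obtain ⟨h3, h4⟩ := ih' (i := j) (by omega)
      exact ⟨by positivity, by gcongr⟩

lemma ghFunctional_X_pow_nonneg {N : ℕ} (hN : 1 ≤ N) (m : ℕ) : 0 ≤ ghFunctional N (X ^ m) := by
  simpa [physHermite] using (ghFunctional_X_pow_mul_physHermite_mem (m := m) hN).1

lemma ghFunctional_X_pow_le {N : ℕ} (hN : 1 ≤ N) (m : ℕ) :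
    ghFunctional N (X ^ m) ≤ gaussianFunctional (X ^ m) := by
  simpa [physHermite] using (ghFunctional_X_pow_mul_physHermite_mem (m := m) hN).2

/-! ### Moments -/

/-- Recursion for the moments of the Gaussian weight. -/
lemma gaussianFunctional_X_pow_add_two (m : ℕ) :
    gaussianFunctional (X ^ (m + 2)) = (m + 1 : ℝ) / 2 * gaussianFunctional (X ^ m) := by
  have h := gaussianFunctional_sub_derivative (X ^ (m + 1))
  have e : (2 * X * X ^ (m + 1) - derivative (X ^ (m + 1)) : ℝ[X]) =
      (2 : ℝ) • X ^ (m + 2) - (m + 1 : ℝ) • X ^ m := by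
    rw [derivative_X_pow, smul_eq_C_mul, smul_eq_C_mul, show (2 : ℝ[X]) = C 2 from rfl]
    simp
    ring
  rw [e, map_sub, map_smul, map_smul, smul_eq_mul, smul_eq_mul] at h
  linarith

lemma gaussianFunctional_X_pow_odd (k : ℕ) : gaussianFunctional (X ^ (2 * k + 1)) = 0 := by
  induction k with
  | zero =>
    have h := map_X_pow_succ_mul_physHermite_zero gaussianFunctional 0
    rw [gaussianFunctional_X_pow_mul_physHermite_eq_zero one_pos, physHermite, mul_one,
      mul_zero] at h
    exact h
  | succ k ih =>
    rw [show 2 * (k + 1) + 1 = 2 * k + 1 + 2 by ring, gaussianFunctional_X_pow_add_two, ih,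
      mul_zero]

lemma gaussianFunctional_X_pow_even (k : ℕ) : gaussianFunctional (X ^ (2 * k)) =
    Real.sqrt Real.pi * ((2 * k).factorial / (4 ^ k * k.factorial)) := by
  induction k with
  | zero => simp [gaussianFunctional_one]
  | succ k ih =>
    rw [show 2 * (k + 1) = 2 * k + 2 by ring, gaussianFunctional_X_pow_add_two, ih,
      Nat.factorial_succ, Nat.factorial_succ, Nat.factorial_succ]
    have h1 : (k.factorial : ℝ) ≠ 0 := Nat.cast_ne_zero.2 k.factorial_ne_zero
    push_cast
    field_simp
    ring

/-- Squeezed between zero and the vanishing Gaussian moment, without appeal to the symmetry of the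
nodes. -/
lemma ghFunctional_X_pow_odd {N : ℕ} (hN : 1 ≤ N) (k : ℕ) :
    ghFunctional N (X ^ (2 * k + 1)) = 0 :=
  le_antisymm ((ghFunctional_X_pow_le hN _).trans_eq (gaussianFunctional_X_pow_odd k))
    (ghFunctional_X_pow_nonneg hN _)

/-! ### The coefficients of the remainder series -/

/-- The coefficient of `(α B ^ 2) ^ k` in `exp (α B ^ 2) - π^{-1/2} ∑ w_n exp (-2 x_n √α B)`. -/
noncomputable def ghRemainderCoeff (N k : ℕ) : ℝ :=
  1 / k.factorial - 4 ^ k / (2 * k).factorial * (ghFunctional N (X ^ (2 * k)) / Real.sqrt Real.pi)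

lemma ghRemainderCoeff_le {N : ℕ} (hN : 1 ≤ N) (k : ℕ) :
    ghRemainderCoeff N k ≤ 1 / k.factorial := by
  have := ghFunctional_X_pow_nonneg hN (2 * k)
  unfold ghRemainderCoeff
  have : 0 ≤ (4 : ℝ) ^ k / (2 * k).factorial *
    (ghFunctional N (X ^ (2 * k)) / Real.sqrt Real.pi) := by positivity
  linarith

lemma ghRemainderCoeff_eq (N k : ℕ) : ghRemainderCoeff N k = 4 ^ k / (2 * k).factorial *
    ((gaussianFunctional (X ^ (2 * k)) - ghFunctional N (X ^ (2 * k))) / Real.sqrt Real.pi) := by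
  rw [gaussianFunctional_X_pow_even, ghRemainderCoeff]
  have h1 : (k.factorial : ℝ) ≠ 0 := Nat.cast_ne_zero.2 k.factorial_ne_zero
  have h2 : ((2 * k).factorial : ℝ) ≠ 0 := Nat.cast_ne_zero.2 (2 * k).factorial_ne_zero
  have h3 : Real.sqrt Real.pi ≠ 0 := (Real.sqrt_pos.2 Real.pi_pos).ne'
  field_simp

lemma ghRemainderCoeff_nonneg {N : ℕ} (hN : 1 ≤ N) (k : ℕ) : 0 ≤ ghRemainderCoeff N k := by
  have := sub_nonneg.2 (ghFunctional_X_pow_le hN (2 * k))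
  rw [ghRemainderCoeff_eq]
  positivity

lemma ghRemainderCoeff_eq_zero {N k : ℕ} (h : k < N) : ghRemainderCoeff N k = 0 := by
  rw [ghRemainderCoeff_eq, ghFunctional_eq_gaussianFunctional (by omega)
    (by rw [natDegree_X_pow]; omega)]
  simp

lemma csqrt_sq (α : ℝ) : csqrt α ^ 2 = α := by
  rw [csqrt, one_div]
  exact_mod_cast Complex.cpow_nat_inv_pow (α : ℂ) two_ne_zero

/-- A power series whose odd coefficients vanish. -/
lemma HasSum.even_of_odd_eq_zero {A : Type*} [NormedRing A] {f : ℕ → A} {s : A}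
    (h : HasSum f s) (hodd : ∀ k, f (2 * k + 1) = 0) : HasSum (fun k => f (2 * k)) s := by
  have hinj : Function.Injective fun k : ℕ => 2 * k := fun a b h => by simpa using h
  refine (hinj.hasSum_iff ?_).2 h
  intro m hm
  rcases Nat.even_or_odd' m with ⟨k, rfl | rfl⟩
  · exact absurd ⟨k, rfl⟩ hm
  · exact hodd k

/-- A Banach algebra covers both uses at once: `ℂ` for the scalar remainder, bounded operators for
the operator one. -/
lemma hasSum_ghFunctional_smul {A : Type*} [NormedRing A] [NormedAlgebra ℂ A]
    [CompleteSpace A] (N : ℕ) (r : ℂ) (B : A) :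
    HasSum (fun m => ((-2 * r) ^ m * (m.factorial : ℂ)⁻¹ *
      (ghFunctional N (X ^ m) : ℂ)) • B ^ m)
      (∑ x ∈ ghNodes N, (ghWeight N x : ℂ) •
        NormedSpace.exp ((-2 * (x : ℂ) * r) • B)) := by
  have h1 := hasSum_sum (s := ghNodes N) fun x _ =>
    (NormedSpace.exp_series_hasSum_exp' (𝕂 := ℂ) ((-2 * (x : ℂ) * r) • B)).const_smul
      (ghWeight N x : ℂ)
  refine h1.congr_fun fun m => Eq.symm ?_
  rw [ghFunctional_apply]
  push_cast
  rw [Finset.mul_sum, Finset.sum_smul]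
  refine Finset.sum_congr rfl fun x _ => ?_
  rw [_root_.smul_pow, smul_smul, smul_smul]
  congr 1
  simp only [eval_pow, eval_X]
  push_cast
  ring

/-- The power series of the remainder of the Gauss-Hermite rule in a Banach algebra. -/
lemma hasSum_ghRemainderCoeff_smul {A : Type*} [NormedRing A] [NormedAlgebra ℂ A]
    [CompleteSpace A] {N : ℕ} (hN : 1 ≤ N) (α : ℝ) (B : A) :
    HasSum (fun k => (ghRemainderCoeff N k : ℂ) • ((α : ℂ) • B ^ 2) ^ k)
      (NormedSpace.exp ((α : ℂ) • B ^ 2) - (1 / (Real.sqrt Real.pi : ℂ)) •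
        ∑ x ∈ ghNodes N, (ghWeight N x : ℂ) •
          NormedSpace.exp ((-2 * (x : ℂ) * csqrt α) • B)) := by
  have heven := (hasSum_ghFunctional_smul N (csqrt α) B).even_of_odd_eq_zero fun k => by
    rw [ghFunctional_X_pow_odd hN, Complex.ofReal_zero, mul_zero, zero_smul]
  have h := (NormedSpace.exp_series_hasSum_exp' (𝕂 := ℂ) ((α : ℂ) • B ^ 2)).sub
    (heven.const_smul (1 / (Real.sqrt Real.pi : ℂ)))
  refine h.congr_fun fun k => Eq.symm ?_
  rw [_root_.smul_pow, ← pow_mul, smul_smul, smul_smul, smul_smul, ← sub_smul,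
    pow_mul (-2 * csqrt α), mul_pow, csqrt_sq, ghRemainderCoeff]
  congr 1
  push_cast
  rw [mul_pow]
  ring

lemma hsIntegral_eq (α b : ℝ) :
    hsIntegral α b = (Real.sqrt Real.pi : ℂ) * Complex.exp ((α * b ^ 2 : ℝ) : ℂ) := by
  have h := integral_cexp_quadratic (b := -1) (by simp) (-2 * csqrt α * b) 0
  rw [hsIntegral]
  have e : ∀ x : ℝ, -(x : ℂ) ^ 2 - 2 * (x : ℂ) * csqrt α * (b : ℂ) =
      -1 * (x : ℂ) ^ 2 + (-2 * csqrt α * b) * x + 0 := fun x => by ring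
  simp only [e]
  rw [h]
  congr 1
  · rw [neg_neg, div_one, Real.sqrt_eq_rpow, Complex.ofReal_cpow Real.pi_pos.le]
    norm_num
  · congr 1
    push_cast
    rw [← csqrt_sq α]
    ring

lemma exp_eq_inv_sqrt_pi_mul_hsIntegral (α b : ℝ) :
    ((Real.exp (α * b ^ 2) : ℝ) : ℂ) = (1 / (Real.sqrt Real.pi : ℂ)) * hsIntegral α b := by
  have h3 : (Real.sqrt Real.pi : ℂ) ≠ 0 := by
    exact_mod_cast (Real.sqrt_pos.2 Real.pi_pos).ne'
  rw [hsIntegral_eq]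
  push_cast
  field_simp

lemma hasSum_hsRemainder {N : ℕ} (hN : 1 ≤ N) (α b : ℝ) :
    HasSum (fun k => ((ghRemainderCoeff N k * (α * b ^ 2) ^ k : ℝ) : ℂ))
      ((1 / (Real.sqrt Real.pi : ℂ)) * hsRemainder N α b) := by
  have h := hasSum_ghRemainderCoeff_smul hN α (b : ℂ)
  have e : NormedSpace.exp ((α : ℂ) • (b : ℂ) ^ 2) - (1 / (Real.sqrt Real.pi : ℂ)) •
        ∑ x ∈ ghNodes N, (ghWeight N x : ℂ) •
          NormedSpace.exp ((-2 * (x : ℂ) * csqrt α) • (b : ℂ)) =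
      (1 / (Real.sqrt Real.pi : ℂ)) * hsRemainder N α b := by
    rw [hsRemainder, mul_sub, ← exp_eq_inv_sqrt_pi_mul_hsIntegral, hsQuadrature]
    simp [Complex.exp_eq_exp_ℂ]
  rw [e] at h
  refine h.congr_fun fun k => Eq.symm ?_
  simp

/-! ### The first coefficients for few nodes -/

/-- The rule sees a polynomial only modulo `H_N`, so for small `N` its moments satisfy a recursion
read off from `H_N`. -/
lemma ghFunctional_congr {N : ℕ} {p q : ℝ[X]}
    (h : ∀ x, (physHermite N).eval x = 0 → p.eval x = q.eval x) :
    ghFunctional N p = ghFunctional N q := by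
  rw [ghFunctional_apply, ghFunctional_apply]
  exact Finset.sum_congr rfl fun x hx => by rw [h x (mem_ghNodes.1 hx)]

lemma ghFunctional_X_pow_zero {N : ℕ} (hN : 1 ≤ N) :
    ghFunctional N (X ^ 0) = Real.sqrt Real.pi := by
  rw [ghFunctional_eq_gaussianFunctional hN (by simp), pow_zero, gaussianFunctional_one]

lemma ghFunctional_X_pow_two {N : ℕ} (hN : 2 ≤ N) :
    ghFunctional N (X ^ 2) = Real.sqrt Real.pi / 2 := by
  rw [ghFunctional_eq_gaussianFunctional (by omega) (by rw [natDegree_X_pow]; omega),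
    gaussianFunctional_X_pow_add_two 0, pow_zero, gaussianFunctional_one]
  norm_num
  ring

lemma ghFunctional_one_X_pow_succ (m : ℕ) : ghFunctional 1 (X ^ (m + 1)) = 0 := by
  rw [ghFunctional_congr (q := 0), map_zero]
  intro x hx
  have : x = 0 := by simpa [physHermite] using hx
  simp [this]

lemma ghFunctional_two_X_pow_add_two (m : ℕ) :
    ghFunctional 2 (X ^ (m + 2)) = 1 / 2 * ghFunctional 2 (X ^ m) := by
  rw [← smul_eq_mul, ← map_smul]
  refine ghFunctional_congr fun x hx => ?_
  rw [eval_physHermite_add_two] at hx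
  simp only [physHermite, eval_mul, eval_sub, eval_X, eval_ofNat, eval_one, derivative_one,
    eval_zero] at hx
  simp only [eval_pow, eval_X, eval_smul, smul_eq_mul]
  push_cast at hx
  linear_combination (x ^ m / 4) * hx

lemma ghFunctional_three_X_pow_add_three (m : ℕ) :
    ghFunctional 3 (X ^ (m + 3)) = 3 / 2 * ghFunctional 3 (X ^ (m + 1)) := by
  rw [← smul_eq_mul, ← map_smul]
  refine ghFunctional_congr fun x hx => ?_
  rw [eval_physHermite_add_two, eval_physHermite_add_two] at hx
  simp only [physHermite, eval_mul, eval_sub, eval_X, eval_ofNat, eval_one, derivative_one,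
    eval_zero] at hx
  simp only [eval_pow, eval_X, eval_smul, smul_eq_mul]
  push_cast at hx
  linear_combination (x ^ m / 8) * hx

lemma ghRemainderCoeff_of_ghFunctional_eq {N k : ℕ} {q : ℝ}
    (h : ghFunctional N (X ^ (2 * k)) = Real.sqrt Real.pi * q) :
    ghRemainderCoeff N k = 1 / k.factorial - 4 ^ k / (2 * k).factorial * q := by
  rw [ghRemainderCoeff, h, mul_div_cancel_left₀ _ (Real.sqrt_pos.2 Real.pi_pos).ne']

lemma ghRemainderCoeff_one_succ (k : ℕ) :
    ghRemainderCoeff 1 (k + 1) = 1 / (k + 1).factorial := by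
  rw [ghRemainderCoeff_of_ghFunctional_eq (q := 0)]
  · simp
  · rw [show 2 * (k + 1) = 2 * k + 1 + 1 by ring, ghFunctional_one_X_pow_succ, mul_zero]

lemma ghFunctional_two_X_pow_even (k : ℕ) :
    ghFunctional 2 (X ^ (2 * k)) = Real.sqrt Real.pi * (1 / 2) ^ k := by
  induction k with
  | zero => rw [mul_zero, ghFunctional_X_pow_zero one_le_two]; simp
  | succ k ih =>
    rw [show 2 * (k + 1) = 2 * k + 2 by ring, ghFunctional_two_X_pow_add_two, ih]
    ring

lemma ghFunctional_three_X_pow_even (k : ℕ) :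
    ghFunctional 3 (X ^ (2 * (k + 1))) = Real.sqrt Real.pi * ((3 / 2) ^ k / 2) := by
  induction k with
  | zero => rw [zero_add, mul_one, ghFunctional_X_pow_two (by norm_num)]; ring
  | succ k ih =>
    rw [show 2 * (k + 1 + 1) = 2 * k + 1 + 3 by ring, ghFunctional_three_X_pow_add_three,
      show 2 * k + 1 + 1 = 2 * (k + 1) by ring, ih]
    ring

lemma ghRemainderCoeff_two (k : ℕ) :
    ghRemainderCoeff 2 k = 1 / k.factorial - 4 ^ k / (2 * k).factorial * (1 / 2) ^ k :=
  ghRemainderCoeff_of_ghFunctional_eq (ghFunctional_two_X_pow_even k)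

lemma ghRemainderCoeff_three (k : ℕ) : ghRemainderCoeff 3 (k + 1) =
    1 / (k + 1).factorial - 4 ^ (k + 1) / (2 * (k + 1)).factorial * ((3 / 2) ^ k / 2) :=
  ghRemainderCoeff_of_ghFunctional_eq (ghFunctional_three_X_pow_even k)

/-! ### Estimates for power series dominated by the exponential series -/

/-- The tail of a power series dominated by the exponential series. -/
lemma abs_sub_sum_range_le_of_coeff_le {c : ℕ → ℝ} {s F : ℝ} (hc : ∀ k, |c k| ≤ 1 / k.factorial)
    (hF : HasSum (fun k => c k * s ^ k) F) (n : ℕ) (hs : 2 * |s| ≤ n + 1) :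
    |F - ∑ k ∈ Finset.range n, c k * s ^ k| ≤ 2 * |s| ^ n / n.factorial := by
  have h1 := (hasSum_nat_add_iff' n).2 hF
  have h2 : HasSum (fun k : ℕ => |s| ^ n / n.factorial * (1 / 2 : ℝ) ^ k)
      (|s| ^ n / n.factorial * 2) := hasSum_geometric_two.mul_left _
  -- By `n! (n + 1) ^ k ≤ (n + k)!` the tail is dominated by a geometric series of ratio `|s| / (n +
  -- 1) ≤ 1 / 2`, whence the factor 2.
  have h3 := tsum_of_norm_bounded h2 (f := fun k => c (k + n) * s ^ (k + n)) fun k => by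
    rw [Real.norm_eq_abs, abs_mul, abs_pow]
    have hf : (n.factorial : ℝ) * (n + 1 : ℝ) ^ k ≤ (k + n).factorial := by
      rw [add_comm k n]
      exact_mod_cast Nat.factorial_mul_pow_le_factorial
    have hn : (0 : ℝ) < n.factorial := by exact_mod_cast n.factorial_pos
    have hn1 : (0 : ℝ) < (n : ℝ) + 1 := by positivity
    calc |c (k + n)| * |s| ^ (k + n) ≤ 1 / (k + n).factorial * |s| ^ (k + n) := by
          gcongr; exact hc _
      _ ≤ 1 / (n.factorial * (n + 1 : ℝ) ^ k) * |s| ^ (k + n) := by gcongr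
      _ = |s| ^ n / n.factorial * (|s| / (n + 1)) ^ k := by
          rw [pow_add, div_pow]; field_simp
      _ ≤ |s| ^ n / n.factorial * (1 / 2 : ℝ) ^ k := by
          gcongr ?_ * ?_ ^ k
          rw [div_le_div_iff₀ hn1 two_pos]; linarith
  rw [h1.tsum_eq, Real.norm_eq_abs] at h3
  calc _ ≤ _ := h3
    _ = _ := by ring

/-- A power series starting at order `N` with coefficients dominated by `a / (k - N)!`. -/
lemma le_mul_exp_of_coeff_le {c : ℕ → ℝ} {s F a : ℝ} {N : ℕ} (hs : 0 ≤ s)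
    (h0 : ∀ k < N, c k = 0) (hc : ∀ k, c (k + N) ≤ a / k.factorial)
    (hF : HasSum (fun k => c k * s ^ k) F) : F ≤ a * s ^ N * Real.exp s := by
  have h1 := (hasSum_nat_add_iff' N).2 hF
  rw [Finset.sum_eq_zero fun k hk => by rw [h0 k (Finset.mem_range.1 hk), zero_mul],
    sub_zero] at h1
  have h2 : HasSum (fun k : ℕ => a * s ^ N * (s ^ k / k.factorial)) (a * s ^ N * Real.exp s) := by
    rw [Real.exp_eq_exp_ℝ]
    exact (NormedSpace.expSeries_div_hasSum_exp s).mul_left _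
  refine hasSum_le (fun k => ?_) h1 h2
  calc c (k + N) * s ^ (k + N) ≤ a / k.factorial * s ^ (k + N) := by gcongr; exact hc k
    _ = _ := by rw [pow_add]; ring

/-- The remainder is real even when `√α` is imaginary, so the estimates can be made over `ℝ`. -/
lemma exists_hasSum_hsRemainder {N : ℕ} (hN : 1 ≤ N) (α b : ℝ) :
    ∃ F : ℝ, HasSum (fun k => ghRemainderCoeff N k * (α * b ^ 2) ^ k) F ∧
      ‖hsRemainder N α b‖ = Real.sqrt Real.pi * |F| := by
  have h := hasSum_hsRemainder hN α b
  have hs : Summable fun k => ghRemainderCoeff N k * (α * b ^ 2) ^ k := by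
    exact_mod_cast h.summable
  refine ⟨_, hs.hasSum, ?_⟩
  have h2 := h.unique (Complex.hasSum_ofReal.2 hs.hasSum)
  have h3 : (Real.sqrt Real.pi : ℂ) ≠ 0 := by
    exact_mod_cast (Real.sqrt_pos.2 Real.pi_pos).ne'
  have h4 : hsRemainder N α b = (Real.sqrt Real.pi : ℂ) *
      ((∑' k, ghRemainderCoeff N k * (α * b ^ 2) ^ k : ℝ) : ℂ) := by
    rw [← h2]; field_simp
  rw [h4, norm_mul, Complex.norm_real, Complex.norm_real, Real.norm_eq_abs, Real.norm_eq_abs,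
    abs_of_nonneg (Real.sqrt_nonneg _)]

lemma abs_ghRemainderCoeff_le {N : ℕ} (hN : 1 ≤ N) (k : ℕ) :
    |ghRemainderCoeff N k| ≤ 1 / k.factorial := by
  rw [abs_of_nonneg (ghRemainderCoeff_nonneg hN k)]
  exact ghRemainderCoeff_le hN k

lemma ghRemainderCoeff_add_le {N : ℕ} (hN : 1 ≤ N) (k : ℕ) :
    ghRemainderCoeff N (k + N) ≤ 1 / N.factorial / k.factorial := by
  refine (ghRemainderCoeff_le hN _).trans ?_
  rw [div_div]
  have h1 : 0 < N.factorial * k.factorial := by positivity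
  have : N.factorial * k.factorial ≤ (k + N).factorial := by
    rw [add_comm k N]
    exact Nat.le_of_dvd (Nat.factorial_pos _) (Nat.factorial_mul_factorial_dvd_factorial_add N k)
  have h2 : ((N.factorial * k.factorial : ℕ) : ℝ) ≤ ((k + N).factorial : ℕ) := by
    exact_mod_cast this
  have h3 : (0 : ℝ) < ((N.factorial * k.factorial : ℕ) : ℝ) := by exact_mod_cast h1
  push_cast at h2 h3
  gcongr

/-! ### The scalar error bound -/

/-- `√2 π^{1/4} √(cosh 1)` is at least `2.33`. -/
lemma bound_const_le :
    2.33 ≤ Real.sqrt 2 * Real.pi ^ (1 / 4 : ℝ) * Real.sqrt (Real.cosh 1) := by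
  have hc : 1.5416 ≤ Real.cosh 1 := by
    rw [Real.cosh_eq]
    have h1 := Real.exp_one_gt_d9
    have h2 := Real.exp_neg_one_gt_d9
    norm_num at h1 h2 ⊢
    linarith
  have hp : (Real.pi ^ (1 / 4 : ℝ)) ^ 4 = Real.pi := by
    rw [← Real.rpow_natCast, ← Real.rpow_mul Real.pi_pos.le]
    norm_num
  have h2 : Real.sqrt 2 ^ 4 = 4 := by
    rw [show 4 = 2 * 2 from rfl, pow_mul, Real.sq_sqrt (by norm_num)]; norm_num
  have h3 : Real.sqrt (Real.cosh 1) ^ 4 = Real.cosh 1 ^ 2 := by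
    rw [show 4 = 2 * 2 from rfl, pow_mul, Real.sq_sqrt (by positivity)]
  -- Fourth powers clear all roots: compare `2.33 ^ 4` with `4 π cosh² 1`.
  refine le_of_pow_le_pow_left₀ (n := 4) (by norm_num) (by positivity) ?_
  rw [mul_pow, mul_pow, hp, h2, h3]
  have hpi := Real.pi_gt_d2
  have : (1.5416 : ℝ) ^ 2 ≤ Real.cosh 1 ^ 2 := by gcongr
  nlinarith

lemma le_hsBound {C A α b : ℝ} (N : ℕ) (hC : 0 ≤ C)
    (h : A ≤ C * 2.33 * (Real.exp (α * b ^ 2) * Real.sqrt (2 / (2 - |α * b ^ 2|))) *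
      (|α * b ^ 2| / 2) ^ N) : Real.sqrt Real.pi * A ≤ hsBound C N α b := by
  have e : hsBound C N α b = Real.sqrt Real.pi * (C *
      (Real.sqrt 2 * Real.pi ^ (1 / 4 : ℝ) * Real.sqrt (Real.cosh 1)) *
      (Real.exp (α * b ^ 2) * Real.sqrt (2 / (2 - |α * b ^ 2|))) * (|α * b ^ 2| / 2) ^ N) := by
    rw [hsBound, Real.sqrt_mul (by norm_num : (0 : ℝ) ≤ 2)]
    ring
  rw [e]
  gcongr
  refine h.trans ?_
  gcongr
  exact bound_const_le

lemma exp_neg_three_halves_ge : 0.223 ≤ Real.exp (-(3 / 2)) := by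
  refine le_of_pow_le_pow_left₀ (n := 2) (by norm_num) (Real.exp_pos _).le ?_
  rw [← Real.exp_nat_mul, show ((2 : ℕ) : ℝ) * -(3 / 2) = (3 : ℕ) * (-1) by norm_num,
    Real.exp_nat_mul]
  have h := Real.exp_neg_one_gt_d9
  calc (0.223 : ℝ) ^ 2 ≤ 0.36787 ^ 3 := by norm_num
    _ ≤ _ := by gcongr; linarith

/-- The minimum is at `y = 3/2`. After squaring, this is the tangent inequality `4 - 2 y ≤ exp (3 -
2 y)` at that point. -/
lemma exp_neg_mul_sqrt_ge {y : ℝ} (hy : y < 2) :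
    0.446 ≤ Real.exp (-y) * Real.sqrt (2 / (2 - y)) := by
  have h1 : 2 * Real.exp (y - 3 / 2) ≤ Real.sqrt (2 / (2 - y)) := by
    refine Real.le_sqrt_of_sq_le ?_
    rw [le_div_iff₀ (by linarith), mul_pow, ← Real.exp_nat_mul]
    have h := Real.add_one_le_exp (3 - 2 * y)
    have h2 : Real.exp (3 - 2 * y) * Real.exp (((2 : ℕ) : ℝ) * (y - 3 / 2)) = 1 := by
      rw [← Real.exp_add, Real.exp_eq_one_iff]; push_cast; ring
    nlinarith [Real.exp_pos (((2 : ℕ) : ℝ) * (y - 3 / 2))]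
  calc 0.446 ≤ 2 * Real.exp (-(3 / 2)) := by linarith [exp_neg_three_halves_ge]
    _ = Real.exp (-y) * (2 * Real.exp (y - 3 / 2)) := by
        rw [mul_left_comm, ← Real.exp_add]; ring_nf
    _ ≤ _ := by gcongr

/-- A bound sharper for small `y`: it follows from `2 - y ≤ exp (1 - y)`, and 0.857 lies just below
`√(2 / e)`. -/
lemma exp_neg_mul_sqrt_ge' {y : ℝ} (hy : y < 2) :
    0.857 * Real.exp (-(y / 2)) ≤ Real.exp (-y) * Real.sqrt (2 / (2 - y)) := by
  have h1 : 0.857 * Real.exp (y / 2) ≤ Real.sqrt (2 / (2 - y)) := by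
    refine Real.le_sqrt_of_sq_le ?_
    rw [le_div_iff₀ (by linarith), mul_pow, ← Real.exp_nat_mul]
    have h := Real.add_one_le_exp (1 - y)
    have h2 : Real.exp (1 - y) * Real.exp (((2 : ℕ) : ℝ) * (y / 2)) = Real.exp 1 := by
      rw [← Real.exp_add]; push_cast; ring_nf
    have h3 := Real.exp_one_lt_d9
    nlinarith [Real.exp_pos (((2 : ℕ) : ℝ) * (y / 2))]
  calc _ = Real.exp (-y) * (0.857 * Real.exp (y / 2)) := by
        rw [mul_left_comm, ← Real.exp_add]; ring_nf
    _ ≤ _ := by gcongr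

lemma one_le_sqrt_two_div {y : ℝ} (h0 : 0 ≤ y) (hy : y < 2) : 1 ≤ Real.sqrt (2 / (2 - y)) := by
  rw [Real.one_le_sqrt, one_le_div (by linarith)]; linarith

/-- The scalar error bound for nonnegative argument. -/
lemma abs_le_of_nonneg {N : ℕ} (hN : 1 ≤ N) {s F K a : ℝ} (hs : 0 ≤ s) (hs2 : s < 2)
    (hF : HasSum (fun k => ghRemainderCoeff N k * s ^ k) F)
    (ha : ∀ k, ghRemainderCoeff N (k + N) ≤ a / k.factorial) (hK : 0 ≤ K) (haK : a * 2 ^ N ≤ K) :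
    |F| ≤ K * (Real.exp s * Real.sqrt (2 / (2 - |s|))) * (|s| / 2) ^ N := by
  have h0 : 0 ≤ F := hF.nonneg fun k =>
    mul_nonneg (ghRemainderCoeff_nonneg hN k) (pow_nonneg hs k)
  rw [abs_of_nonneg h0, abs_of_nonneg hs]
  calc F ≤ a * s ^ N * Real.exp s :=
        le_mul_exp_of_coeff_le hs (fun k hk => ghRemainderCoeff_eq_zero hk) ha hF
    _ = (a * 2 ^ N) * (Real.exp s * 1) * (s / 2) ^ N := by rw [div_pow]; field_simp
    _ ≤ _ := by
        gcongr
        exact one_le_sqrt_two_div hs hs2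

lemma two_pow_div_factorial_le (n : ℕ) : (2 : ℝ) ^ (n + 3) / (n + 3).factorial ≤ 4 / 3 := by
  induction n with
  | zero => norm_num [Nat.factorial]
  | succ n ih =>
    rw [show n + 1 + 3 = n + 3 + 1 by ring, pow_succ, Nat.factorial_succ]
    push_cast
    calc (2 : ℝ) ^ (n + 3) * 2 / ((n + 3 + 1) * (n + 3).factorial) =
        2 ^ (n + 3) / (n + 3).factorial * (2 / (n + 3 + 1)) := by field_simp
      _ ≤ 4 / 3 * 1 := by
        gcongr
        rw [div_le_one (by positivity)]
        have : (0 : ℝ) ≤ n := n.cast_nonneg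
        linarith
      _ = 4 / 3 := by ring

lemma two_pow_div_factorial_le' (n : ℕ) : (2 : ℝ) ^ (n + 5) / (n + 5).factorial ≤ 4 / 15 := by
  induction n with
  | zero => norm_num [Nat.factorial]
  | succ n ih =>
    rw [show n + 1 + 5 = n + 5 + 1 by ring, pow_succ, Nat.factorial_succ]
    push_cast
    calc (2 : ℝ) ^ (n + 5) * 2 / ((n + 5 + 1) * (n + 5).factorial) =
        2 ^ (n + 5) / (n + 5).factorial * (2 / (n + 5 + 1)) := by field_simp
      _ ≤ 4 / 15 * 1 := by
        gcongr
        rw [div_le_one (by positivity)]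
        have : (0 : ℝ) ≤ n := n.cast_nonneg
        linarith
      _ = 4 / 15 := by ring

/-! ### The scalar bound for negative argument `-y` -/

section Negative

variable {y F : ℝ}

/-- The target 0.847 is just below `0.816 * 2.33 * 0.446`, the least value of the factor in the
final bound. -/
lemma abs_le_of_neg_of_five_le {N : ℕ} (hN : 5 ≤ N) (h0 : 0 ≤ y) (hy : y < 2)
    (hF : HasSum (fun k => ghRemainderCoeff N k * (-y) ^ k) F) : |F| ≤ 0.847 * (y / 2) ^ N := by
  have hN5 : (5 : ℝ) ≤ N := by exact_mod_cast hN
  have h := abs_sub_sum_range_le_of_coeff_le (abs_ghRemainderCoeff_le (by omega)) hF N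
    (by rw [abs_neg, abs_of_nonneg h0]; linarith)
  rw [Finset.sum_eq_zero fun k hk => by
    rw [ghRemainderCoeff_eq_zero (Finset.mem_range.1 hk), zero_mul], sub_zero, abs_neg,
    abs_of_nonneg h0] at h
  obtain ⟨n, rfl⟩ : ∃ n, N = n + 5 := ⟨N - 5, by omega⟩
  calc |F| ≤ _ := h
    _ = 2 * (2 ^ (n + 5) / (n + 5).factorial) * (y / 2) ^ (n + 5) := by
        rw [div_pow]; field_simp
    _ ≤ 2 * (4 / 15) * (y / 2) ^ (n + 5) := by
        gcongr ?_ * _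
        exact mul_le_mul_of_nonneg_left (two_pow_div_factorial_le' n) two_pos.le
    _ ≤ _ := by gcongr; norm_num

/-- The plain tail bound would give 4/3 instead of 0.847. The terms of orders 4 to 6 are therefore
kept, using their alternating signs and `0 ≤ c_k ≤ 1 / k!`. -/
lemma abs_le_of_neg_four (h0 : 0 ≤ y) (hy : y < 2)
    (hF : HasSum (fun k => ghRemainderCoeff 4 k * (-y) ^ k) F) : |F| ≤ 0.847 * (y / 2) ^ 4 := by
  have h := abs_sub_sum_range_le_of_coeff_le (abs_ghRemainderCoeff_le (by norm_num)) hF 7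
    (by rw [abs_neg, abs_of_nonneg h0]; norm_num; linarith)
  have hz : ∀ k < 4, ghRemainderCoeff 4 k = 0 := fun k hk => ghRemainderCoeff_eq_zero hk
  simp only [Finset.sum_range_succ, Finset.sum_range_zero, hz 0 (by norm_num),
    hz 1 (by norm_num), hz 2 (by norm_num), hz 3 (by norm_num)] at h
  have hn := ghRemainderCoeff_nonneg (N := 4) (by norm_num)
  have hl := ghRemainderCoeff_le (N := 4) (by norm_num)
  have n4 := hn 4
  have n5 := hn 5
  have n6 := hn 6
  have l4 := hl 4
  have l5 := hl 5
  have l6 := hl 6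
  rw [abs_neg, abs_of_nonneg h0, abs_le] at h
  norm_num [Nat.factorial] at h l4 l5 l6
  obtain ⟨ha, hb⟩ := h
  have p4 : 0 ≤ y ^ 4 := by positivity
  have q5 : y ^ 5 ≤ 2 * y ^ 4 := by rw [pow_succ]; nlinarith
  have q6 : y ^ 6 ≤ 4 * y ^ 4 := by
    rw [show y ^ 6 = y ^ 4 * y ^ 2 by ring]; nlinarith
  have q7 : y ^ 7 ≤ 8 * y ^ 4 := by
    rw [show y ^ 7 = y ^ 6 * y by ring]
    nlinarith [pow_nonneg h0 6]
  have r4 := mul_le_mul_of_nonneg_right l4 p4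
  have r5 := mul_le_mul_of_nonneg_right l5 (pow_nonneg h0 5)
  have r6 := mul_le_mul_of_nonneg_right l6 (pow_nonneg h0 6)
  have s4 := mul_nonneg n4 p4
  have s5 := mul_nonneg n5 (pow_nonneg h0 5)
  have s6 := mul_nonneg n6 (pow_nonneg h0 6)
  have e5 : (-y) ^ 5 = -y ^ 5 := by ring
  simp only [e5] at ha hb
  rw [abs_le, show (y / 2) ^ 4 = y ^ 4 / 16 by ring]
  constructor <;> linarith

/-- Here even the leading term is too large if bounded by `1 / 3!`; the exact `c_3 = 1 / 15` and
`c_4 = 13 / 420` are used. -/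
lemma abs_le_of_neg_three (h0 : 0 ≤ y) (hy : y < 2)
    (hF : HasSum (fun k => ghRemainderCoeff 3 k * (-y) ^ k) F) : |F| ≤ 0.847 * (y / 2) ^ 3 := by
  have h := abs_sub_sum_range_le_of_coeff_le (abs_ghRemainderCoeff_le (by norm_num)) hF 6
    (by rw [abs_neg, abs_of_nonneg h0]; norm_num; linarith)
  have hz : ∀ k < 3, ghRemainderCoeff 3 k = 0 := fun k hk => ghRemainderCoeff_eq_zero hk
  have c3 := ghRemainderCoeff_three 2
  have c4 := ghRemainderCoeff_three 3
  have n5 := ghRemainderCoeff_nonneg (N := 3) (by norm_num) 5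
  have l5 := ghRemainderCoeff_le (N := 3) (by norm_num) 5
  norm_num [Nat.factorial] at c3 c4 l5
  simp only [Finset.sum_range_succ, Finset.sum_range_zero, hz 0 (by norm_num),
    hz 1 (by norm_num), hz 2 (by norm_num), c3, c4] at h
  rw [abs_neg, abs_of_nonneg h0, abs_le] at h
  norm_num [Nat.factorial] at h
  obtain ⟨ha, hb⟩ := h
  have p3 : 0 ≤ y ^ 3 := by positivity
  have r5 := mul_le_mul_of_nonneg_right l5 (pow_nonneg h0 5)
  have s5 := mul_nonneg n5 (pow_nonneg h0 5)
  have q4 : y ^ 4 ≤ 2 * y ^ 3 := by rw [pow_succ]; nlinarith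
  have q5 : y ^ 5 ≤ 2 * y ^ 4 := by rw [pow_succ]; nlinarith [pow_nonneg h0 4]
  have q6 : y ^ 6 ≤ 2 * y ^ 5 := by rw [pow_succ]; nlinarith [pow_nonneg h0 5]
  have e3 : (-y) ^ 3 = -y ^ 3 := by ring
  have e5 : (-y) ^ 5 = -y ^ 5 := by ring
  simp only [e3, e5] at ha hb
  have p4 : 0 ≤ y ^ 4 := by positivity
  rw [abs_le, show (y / 2) ^ 3 = y ^ 3 / 8 by ring]
  constructor <;> linarith

/-- The coefficients through order 4 are exact; in the upper estimate the negative term of order 5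
absorbs the tail bound `2 y ^ 6 / 6!`. -/
lemma abs_le_of_neg_two (h0 : 0 ≤ y) (hy : y < 2)
    (hF : HasSum (fun k => ghRemainderCoeff 2 k * (-y) ^ k) F) :
    |F| ≤ y ^ 2 * (1 / 3 - 7 / 45 * y + 13 / 315 * y ^ 2) := by
  have h := abs_sub_sum_range_le_of_coeff_le (abs_ghRemainderCoeff_le (by norm_num)) hF 6
    (by rw [abs_neg, abs_of_nonneg h0]; norm_num; linarith)
  simp only [Finset.sum_range_succ, Finset.sum_range_zero, ghRemainderCoeff_two] at h
  rw [abs_neg, abs_of_nonneg h0, abs_le] at h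
  norm_num [Nat.factorial] at h
  obtain ⟨ha, hb⟩ := h
  have p5 : 0 ≤ y ^ 5 := by positivity
  have p2 : 0 ≤ y ^ 2 := by positivity
  have q3 : y ^ 3 ≤ 2 * y ^ 2 := by rw [pow_succ]; nlinarith
  have q4 : y ^ 4 ≤ 2 * y ^ 3 := by rw [pow_succ]; nlinarith [pow_nonneg h0 3]
  have q5 : y ^ 5 ≤ 2 * y ^ 4 := by rw [pow_succ]; nlinarith [pow_nonneg h0 4]
  have q6 : y ^ 6 ≤ 2 * y ^ 5 := by rw [pow_succ]; nlinarith [pow_nonneg h0 5]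
  have e3 : (-y) ^ 3 = -y ^ 3 := by ring
  have e5 : (-y) ^ 5 = -y ^ 5 := by ring
  simp only [e3, e5] at ha hb
  have p4 : 0 ≤ y ^ 4 := by positivity
  rw [abs_le]
  constructor <;> nlinarith

lemma abs_le_bound_of_neg_two (h0 : 0 ≤ y) (hy : y < 2)
    (hF : HasSum (fun k => ghRemainderCoeff 2 k * (-y) ^ k) F) :
    |F| ≤ 0.816 * 2.33 * (Real.exp (-y) * Real.sqrt (2 / (2 - y))) * (y / 2) ^ 2 := by
  have h := abs_le_of_neg_two h0 hy hF
  have key : 1 / 3 - 7 / 45 * y + 13 / 315 * y ^ 2 ≤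
      0.816 * 2.33 / 4 * (Real.exp (-y) * Real.sqrt (2 / (2 - y))) := by
    -- The constant bound 0.446 is too weak near `y = 0`, where the polynomial is 1/3; the decaying
    -- bound takes over there.
    rcases le_total y 1.2 with h1 | h1
    · have hg := exp_neg_mul_sqrt_ge' hy
      have he := Real.exp_bound (x := -(y / 2))
        (by rw [abs_neg, abs_of_nonneg (by linarith)]; linarith) (n := 4) (by norm_num)
      rw [abs_neg, abs_of_nonneg (by linarith : 0 ≤ y / 2), abs_le] at he
      norm_num [Finset.sum_range_succ, Nat.factorial] at he
      have he1 := he.1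
      have p : 1 / 3 - 7 / 45 * y + 13 / 315 * y ^ 2 ≤ 0.816 * 2.33 / 4 * (0.857 *
          (1 - y / 2 + y ^ 2 / 8 - y ^ 3 / 48 - 5 / 96 * (y / 2) ^ 4)) := by
        have hc : y ^ 3 ≤ 1.2 * y ^ 2 := by rw [pow_succ]; nlinarith
        have hd : y ^ 4 ≤ 1.44 * y ^ 2 := by
          rw [show y ^ 4 = y ^ 2 * y ^ 2 by ring]; nlinarith
        rw [show (y / 2) ^ 4 = y ^ 4 / 16 by ring]
        nlinarith
      refine p.trans (mul_le_mul_of_nonneg_left (le_trans ?_ hg) (by norm_num))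
      refine mul_le_mul_of_nonneg_left ?_ (by norm_num)
      nlinarith
    · have hg := exp_neg_mul_sqrt_ge hy
      nlinarith
  calc |F| ≤ _ := h
    _ ≤ y ^ 2 * (0.816 * 2.33 / 4 * (Real.exp (-y) * Real.sqrt (2 / (2 - y)))) := by gcongr
    _ = _ := by ring

lemma abs_le_bound_of_neg_one (h0 : 0 ≤ y) (hy : y < 2)
    (hF : HasSum (fun k => ghRemainderCoeff 1 k * (-y) ^ k) F) :
    |F| ≤ 1.1 * 2.33 * (Real.exp (-y) * Real.sqrt (2 / (2 - y))) * (y / 2) ^ 1 := by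
  have h1 := (hasSum_nat_add_iff' 1).2 hF
  have h2 : HasSum (fun k : ℕ => (-y) ^ k / k.factorial) (Real.exp (-y)) := by
    rw [Real.exp_eq_exp_ℝ]
    exact NormedSpace.expSeries_div_hasSum_exp (-y)
  have h3 := (hasSum_nat_add_iff' 1).2 h2
  have h4 : F = Real.exp (-y) - 1 := by
    have := h1.unique (h3.congr_fun fun k => by rw [ghRemainderCoeff_one_succ]; ring)
    simpa [ghRemainderCoeff_eq_zero] using this
  have h5 : Real.exp (-y) ≤ 1 := Real.exp_le_one_iff.2 (by linarith)
  rw [h4, abs_of_nonpos (by linarith), pow_one]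
  -- For small `y`, write `1 - exp (-y) = 2 sinh (y / 2) exp (-(y / 2))` and bound `sinh` by its
  -- Taylor polynomial; otherwise bound `exp (-y)` below by a tangent at `3/2`.
  rcases le_total y 1.4 with h6 | h6
  · have hg := exp_neg_mul_sqrt_ge' hy
    have hE : Real.exp (-y) = Real.exp (-(y / 2)) * Real.exp (-(y / 2)) := by
      rw [← Real.exp_add]; ring_nf
    have hI : Real.exp (y / 2) * Real.exp (-(y / 2)) = 1 := by
      rw [← Real.exp_add]; simp
    have b1 := Real.exp_bound (x := y / 2)
      (by rw [abs_of_nonneg (by linarith)]; linarith) (n := 5) (by norm_num)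
    have b2 := Real.exp_bound (x := -(y / 2))
      (by rw [abs_neg, abs_of_nonneg (by linarith)]; linarith) (n := 5) (by norm_num)
    rw [abs_neg] at b2
    rw [abs_of_nonneg (by linarith : 0 ≤ y / 2), abs_le] at b1 b2
    norm_num [Finset.sum_range_succ, Nat.factorial] at b1 b2
    have d1 := b1.2
    have d2 := b2.1
    have hsinh : Real.exp (y / 2) - Real.exp (-(y / 2)) ≤ 1.1 * 2.33 * 0.857 * (y / 2) := by
      set t := y / 2
      have ht0 : 0 ≤ t := by positivity
      have ht : t ≤ 0.7 := by simp only [t]; linarith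
      have hc : t ^ 3 ≤ 0.49 * t := by
        rw [show t ^ 3 = t * t ^ 2 by ring]; nlinarith
      have hd : t ^ 5 ≤ 0.49 * t ^ 3 := by
        rw [show t ^ 5 = t ^ 3 * t ^ 2 by ring]; nlinarith [pow_nonneg ht0 3]
      have e3 : (-t) ^ 3 = -t ^ 3 := by ring
      simp only [e3] at d2
      linarith
    have h7 := mul_le_mul_of_nonneg_right hsinh (Real.exp_pos (-(y / 2))).le
    have h8 := mul_le_mul_of_nonneg_right hg (by positivity : 0 ≤ 1.1 * 2.33 * (y / 2))
    nlinarith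
  · have hg := exp_neg_mul_sqrt_ge hy
    have hl : 0.223 * (2.5 - y) ≤ Real.exp (-y) := by
      have e : Real.exp (-y) = Real.exp (-(3 / 2)) * Real.exp (3 / 2 - y) := by
        rw [← Real.exp_add]; ring_nf
      have := Real.add_one_le_exp (3 / 2 - y)
      rw [e]
      calc _ ≤ 0.223 * Real.exp (3 / 2 - y) := by
            refine mul_le_mul_of_nonneg_left ?_ (by norm_num); linarith
        _ ≤ _ := by gcongr; exact exp_neg_three_halves_ge
    nlinarith

lemma abs_le_bound_of_neg {N : ℕ} (hN : 2 ≤ N) (h0 : 0 ≤ y) (hy : y < 2)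
    (hF : HasSum (fun k => ghRemainderCoeff N k * (-y) ^ k) F) :
    |F| ≤ 0.816 * 2.33 * (Real.exp (-y) * Real.sqrt (2 / (2 - y))) * (y / 2) ^ N := by
  rcases hN.eq_or_lt with rfl | hN
  · exact abs_le_bound_of_neg_two h0 hy hF
  have h : |F| ≤ 0.847 * (y / 2) ^ N := by
    by_cases h5 : 5 ≤ N
    · exact abs_le_of_neg_of_five_le h5 h0 hy hF
    · obtain rfl | rfl : N = 3 ∨ N = 4 := by omega
      · exact abs_le_of_neg_three h0 hy hF
      · exact abs_le_of_neg_four h0 hy hF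
  refine h.trans ?_
  gcongr
  linarith [exp_neg_mul_sqrt_ge hy]

end Negative

/-! ### The scalar bound for both signs -/

lemma norm_hsRemainder_le {N : ℕ} (hN : 2 ≤ N) (α b : ℝ) (h : |α * b ^ 2| < 2) :
    ‖hsRemainder N α b‖ ≤ hsBound 0.816 N α b := by
  obtain ⟨F, hF, hn⟩ := exists_hasSum_hsRemainder (one_le_two.trans hN) α b
  rw [hn]
  refine le_hsBound N (by norm_num) ?_
  rcases le_total 0 (α * b ^ 2) with hs | hs
  · have hs2 : α * b ^ 2 < 2 := (le_abs_self _).trans_lt h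
    rcases hN.eq_or_lt with rfl | hN
    -- The generic `a = 1 / 2!` fails, as `a * 2 ^ 2 = 2` exceeds `0.816 * 2.33`; the exact leading
    -- coefficient 1/3 works.
    · refine abs_le_of_nonneg (a := 1 / 3) one_le_two hs hs2 hF (fun k => ?_) (by norm_num)
        (by norm_num)
      cases k with
      | zero => rw [ghRemainderCoeff_two]; norm_num [Nat.factorial]
      | succ k =>
        refine (ghRemainderCoeff_le one_le_two _).trans ?_
        rw [div_div, show k + 1 + 2 = k + 1 + 1 + 1 from rfl,
          Nat.factorial_succ (k + 1 + 1), Nat.factorial_succ (k + 1)]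
        have h1 : (0 : ℝ) < (k + 1).factorial := by exact_mod_cast (k + 1).factorial_pos
        have h2 : (0 : ℝ) ≤ k := k.cast_nonneg
        push_cast
        refine one_div_le_one_div_of_le (by positivity) ?_
        rw [← mul_assoc]
        refine mul_le_mul_of_nonneg_right ?_ h1.le
        nlinarith
    · refine abs_le_of_nonneg (a := 1 / N.factorial) (by omega) hs hs2 hF
        (ghRemainderCoeff_add_le (by omega)) (by norm_num) ?_
      obtain ⟨n, rfl⟩ : ∃ n, N = n + 3 := ⟨N - 3, by omega⟩
      have := two_pow_div_factorial_le n
      rw [one_div_mul_eq_div]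
      linarith
  · have e := abs_of_nonpos hs
    have := abs_le_bound_of_neg hN (y := |α * b ^ 2|) (F := F) (abs_nonneg _) h
      (by rw [e, neg_neg]; exact hF)
    rw [e, neg_neg] at this
    rw [e]
    exact this

/-- The constant 0.816 would fail here: as `s → 0` the remainder is about `√π s`, whereas that bound
is about `0.954 √π |s|`. -/
lemma norm_hsRemainder_one_le (α b : ℝ) (h : |α * b ^ 2| < 2) :
    ‖hsRemainder 1 α b‖ ≤ hsBound 1.1 1 α b := by
  obtain ⟨F, hF, hn⟩ := exists_hasSum_hsRemainder le_rfl α b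
  rw [hn]
  refine le_hsBound 1 (by norm_num) ?_
  rcases le_total 0 (α * b ^ 2) with hs | hs
  · exact abs_le_of_nonneg (a := 1 / (1 : ℕ).factorial) le_rfl hs ((le_abs_self _).trans_lt h) hF
      (ghRemainderCoeff_add_le le_rfl) (by norm_num) (by norm_num)
  · have e := abs_of_nonpos hs
    have := abs_le_bound_of_neg_one (y := |α * b ^ 2|) (F := F) (abs_nonneg _) h
      (by rw [e, neg_neg]; exact hF)
    rw [e, neg_neg] at this
    rw [e]
    exact this

/-! ### The operator form -/

section Operator

variable {E : Type*} [NormedAddCommGroup E] [NormedSpace ℂ E] [CompleteSpace E]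

lemma exp_clm_apply_of_eigenvector {T : E →L[ℂ] E} {c : ℂ} {v : E} (h : T v = c • v) :
    NormedSpace.exp T v = Complex.exp c • v := by
  have h1 := (ContinuousLinearMap.apply ℂ E v).hasSum
    (NormedSpace.exp_series_hasSum_exp' (𝕂 := ℂ) T)
  have h2 := (NormedSpace.exp_series_hasSum_exp' (𝕂 := ℂ) c).smul_const v
  rw [← Complex.exp_eq_exp_ℂ] at h2
  refine h1.unique (h2.congr_fun fun k => ?_)
  have hk : (T ^ k) v = c ^ k • v := by
    induction k with
    | zero => simp
    | succ k ih =>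
      rw [pow_succ, mul_apply_eq_comp, h, map_smul, ih, smul_smul, pow_succ, mul_comm]
  simp [hk, smul_smul]

lemma exp_smul_sq_apply_of_eigenvector {B : E →L[ℂ] E} {b : ℝ} {v : E}
    (h : B v = (b : ℂ) • v) (α : ℝ) :
    NormedSpace.exp ((α : ℂ) • B ^ 2) v = ((Real.exp (α * b ^ 2) : ℝ) : ℂ) • v := by
  rw [exp_clm_apply_of_eigenvector (c := ((α * b ^ 2 : ℝ) : ℂ)), Complex.ofReal_exp]
  rw [_root_.smul_apply, pow_two, mul_apply_eq_comp, h, map_smul, h,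
    smul_smul, smul_smul]
  push_cast
  ring_nf

lemma hsOperatorRemainder_apply_of_eigenvector {B : E →L[ℂ] E} {b : ℝ} {v : E}
    (h : B v = (b : ℂ) • v) (N : ℕ) (α : ℝ) :
    hsOperatorRemainder N α B v = ((1 / (Real.sqrt Real.pi : ℂ)) * hsRemainder N α b) • v := by
  have hexp : ∀ x : ℝ, NormedSpace.exp ((-2 * (x : ℂ) * csqrt α) • B) v =
      Complex.exp (-2 * (x : ℂ) * csqrt α * (b : ℂ)) • v := fun x =>
    exp_clm_apply_of_eigenvector (by rw [_root_.smul_apply, h, smul_smul])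
  rw [hsOperatorRemainder, hsOperatorSum, hsRemainder, mul_sub,
    ← exp_eq_inv_sqrt_pi_mul_hsIntegral, sub_smul, _root_.sub_apply,
    exp_smul_sq_apply_of_eigenvector h, _root_.smul_apply,
    _root_.sum_apply, hsQuadrature, mul_smul, Finset.sum_smul]
  congr 2
  refine Finset.sum_congr rfl fun x _ => ?_
  rw [_root_.smul_apply, hexp, smul_smul]

/-- The operator remainder is of order `(α B ^ 2) ^ N`, with an explicit constant. -/
lemma norm_hsOperatorRemainder_le {N : ℕ} (hN : 1 ≤ N) (α : ℝ) (B : E →L[ℂ] E) :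
    ‖hsOperatorRemainder N α B‖ ≤ 1 / N.factorial * ‖((α : ℂ) • B ^ 2) ^ N‖ *
      Real.exp (|α| * ‖B‖ ^ 2) := by
  set T : E →L[ℂ] E := (α : ℂ) • B ^ 2 with hT
  have hnT : ‖T‖ ≤ |α| * ‖B‖ ^ 2 := by
    rw [hT, norm_smul, Complex.norm_real, Real.norm_eq_abs]
    gcongr
    exact norm_pow_le' B two_pos
  have h : HasSum (fun k => (ghRemainderCoeff N k : ℂ) • T ^ k) (hsOperatorRemainder N α B) :=
    hasSum_ghRemainderCoeff_smul hN α B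
  have h1 := (hasSum_nat_add_iff' N).2 h
  rw [Finset.sum_eq_zero fun k hk => by
    rw [ghRemainderCoeff_eq_zero (Finset.mem_range.1 hk), Complex.ofReal_zero, zero_smul],
    sub_zero] at h1
  have h2 : HasSum (fun k : ℕ => 1 / N.factorial * ‖T ^ N‖ *
      ((|α| * ‖B‖ ^ 2) ^ k / k.factorial))
      (1 / N.factorial * ‖T ^ N‖ * Real.exp (|α| * ‖B‖ ^ 2)) := by
    rw [Real.exp_eq_exp_ℝ]
    exact (NormedSpace.expSeries_div_hasSum_exp (|α| * ‖B‖ ^ 2)).mul_left _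
  rw [← h1.tsum_eq]
  refine tsum_of_norm_bounded h2 fun k => ?_
  have hk : ‖T ^ (k + N)‖ ≤ (|α| * ‖B‖ ^ 2) ^ k * ‖T ^ N‖ := by
    -- `norm_pow_le'` needs a positive exponent, since `‖1‖ = 0` if `E` is trivial.
    rcases Nat.eq_zero_or_pos k with rfl | hk
    · simp
    · rw [pow_add]
      refine (norm_mul_le _ _).trans ?_
      gcongr
      exact (norm_pow_le' T hk).trans (by gcongr)
  rw [norm_smul, Complex.norm_real, Real.norm_eq_abs,
    abs_of_nonneg (ghRemainderCoeff_nonneg hN _)]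
  calc _ ≤ 1 / N.factorial / k.factorial * ((|α| * ‖B‖ ^ 2) ^ k * ‖T ^ N‖) :=
        mul_le_mul (ghRemainderCoeff_add_le hN k) hk (norm_nonneg _) (by positivity)
    _ = _ := by ring

lemma hsOperatorRemainder_isBigO_nhds {N : ℕ} (hN : 1 ≤ N) (B : E →L[ℂ] E) :
    (fun α : ℝ => hsOperatorRemainder N α B) =O[nhds 0]
      (fun α : ℝ => ((α : ℂ) • B ^ 2) ^ N) := by
  refine Asymptotics.IsBigO.of_bound (1 / N.factorial * Real.exp (1 * ‖B‖ ^ 2)) ?_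
  filter_upwards [Metric.ball_mem_nhds (0 : ℝ) one_pos] with α hα
  have hα' : |α| ≤ 1 := by simpa using (mem_ball_zero_iff.1 hα).le
  refine (norm_hsOperatorRemainder_le hN α B).trans ?_
  rw [mul_right_comm]
  gcongr

lemma hsOperatorRemainder_isBigO_atTop (α : ℝ) (B : E →L[ℂ] E) :
    (fun N : ℕ => hsOperatorRemainder N α B) =O[Filter.atTop]
      (fun N : ℕ => (|α| * ‖B‖ ^ 2 / 2) ^ N) := by
  refine Asymptotics.IsBigO.of_bound (4 / 3 * Real.exp (|α| * ‖B‖ ^ 2)) ?_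
  filter_upwards [Filter.eventually_ge_atTop 3] with N hN
  obtain ⟨n, rfl⟩ : ∃ n, N = n + 3 := ⟨N - 3, by omega⟩
  have hT : ‖((α : ℂ) • B ^ 2) ^ (n + 3)‖ ≤ (|α| * ‖B‖ ^ 2) ^ (n + 3) := by
    refine (norm_pow_le' _ (by omega)).trans ?_
    gcongr
    rw [norm_smul, Complex.norm_real, Real.norm_eq_abs]
    gcongr
    exact norm_pow_le' B two_pos
  calc ‖hsOperatorRemainder (n + 3) α B‖ ≤ _ := norm_hsOperatorRemainder_le (by omega) α B
    _ ≤ 1 / (n + 3).factorial * (|α| * ‖B‖ ^ 2) ^ (n + 3) * Real.exp (|α| * ‖B‖ ^ 2) := by gcongr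
    _ = 2 ^ (n + 3) / (n + 3).factorial * Real.exp (|α| * ‖B‖ ^ 2) *
        (|α| * ‖B‖ ^ 2 / 2) ^ (n + 3) := by rw [div_pow]; field_simp
    _ ≤ 4 / 3 * Real.exp (|α| * ‖B‖ ^ 2) * (|α| * ‖B‖ ^ 2 / 2) ^ (n + 3) := by
        gcongr ?_ * _ * _
        -- The true decay carries a further factor `2 ^ N / N!`, of which only boundedness is used.
        exact two_pow_div_factorial_le n
    _ = _ := by rw [Real.norm_of_nonneg (by positivity)]

end Operator

lemma hsRemainder_isBigO_atTop (α b : ℝ) (h : |α * b ^ 2| < 2) :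
    (fun N : ℕ => hsRemainder N α b) =O[Filter.atTop] (fun N : ℕ => (|α * b ^ 2| / 2) ^ N) := by
  refine Asymptotics.IsBigO.of_bound (0.816 * Real.sqrt (2 * Real.pi) * Real.pi ^ (1 / 4 : ℝ) *
    Real.exp (α * b ^ 2) * Real.sqrt (2 / (2 - |α * b ^ 2|)) * Real.sqrt (Real.cosh 1)) ?_
  filter_upwards [Filter.eventually_ge_atTop 2] with N hN
  refine (norm_hsRemainder_le hN α b h).trans_eq ?_
  rw [Real.norm_of_nonneg (by positivity), hsBound]
  ring

theorem mainTheorem3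
    {E : Type*} [NormedAddCommGroup E] [NormedSpace ℂ E] [CompleteSpace E] (B : E →L[ℂ] E) :
    -- the `N`-point Gauss-Hermite rule: real nodes, positive weights, exactness
    (∀ N : ℕ, 1 ≤ N →
      (ghNodes N).card = N ∧
      (∀ x ∈ ghNodes N, 0 < ghWeight N x) ∧
      (∀ p : Polynomial ℝ, p.natDegree ≤ 2 * N - 1 →
        ∫ x : ℝ, Real.exp (-x ^ 2) * p.eval x = ∑ x ∈ ghNodes N, ghWeight N x * p.eval x)) ∧
    -- the Gaussian integral identity
    (∀ α b : ℝ,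
      ((Real.exp (α * b ^ 2) : ℝ) : ℂ) = (1 / (Real.sqrt Real.pi : ℂ)) * hsIntegral α b) ∧
    -- the explicit error bound
    (∀ N : ℕ, 2 ≤ N → ∀ α b : ℝ, |α * b ^ 2| < 2 →
      ‖hsRemainder N α b‖ ≤ hsBound 0.816 N α b) ∧
    (∀ α b : ℝ, |α * b ^ 2| < 2 → ‖hsRemainder 1 α b‖ ≤ hsBound 1.1 1 α b) ∧
    -- geometric convergence in the number of nodes
    (∀ α b : ℝ, |α * b ^ 2| < 2 →
      (fun N : ℕ => hsRemainder N α b) =O[Filter.atTop] (fun N : ℕ => (|α * b ^ 2| / 2) ^ N)) ∧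
    -- the operator form, on eigenvectors
    (∀ N : ℕ, 1 ≤ N → ∀ (α b : ℝ) (v : E), B v = (b : ℂ) • v →
      NormedSpace.exp ((α : ℂ) • B ^ 2) v = ((Real.exp (α * b ^ 2) : ℝ) : ℂ) • v ∧
      hsOperatorRemainder N α B v =
        ((1 / (Real.sqrt Real.pi : ℂ)) * hsRemainder N α b) • v) ∧
    -- the operator form, in operator norm
    (∀ N : ℕ, 1 ≤ N →
      (fun α : ℝ => hsOperatorRemainder N α B) =O[nhds 0]
        (fun α : ℝ => ((α : ℂ) • B ^ 2) ^ N)) ∧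
    (∀ α : ℝ, |α| * ‖B‖ ^ 2 < 2 →
      (fun N : ℕ => hsOperatorRemainder N α B) =O[Filter.atTop]
        (fun N : ℕ => (|α| * ‖B‖ ^ 2 / 2) ^ N)) := by
  refine ⟨fun N hN => ⟨card_ghNodes N, fun x hx => ghWeight_pos hN hx, fun p hp => ?_⟩,
    exp_eq_inv_sqrt_pi_mul_hsIntegral, fun N hN α b h => norm_hsRemainder_le hN α b h,
    norm_hsRemainder_one_le, hsRemainder_isBigO_atTop, fun N _ α b v hv => ⟨?_, ?_⟩,
    fun N hN => hsOperatorRemainder_isBigO_nhds hN B,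
    fun α _ => hsOperatorRemainder_isBigO_atTop α B⟩
  · exact (ghFunctional_eq_gaussianFunctional hN hp).symm
  · exact exp_smul_sq_apply_of_eigenvector hv α
  · exact hsOperatorRemainder_apply_of_eigenvector hv N α
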